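/- Let $G$ be a locally compact Hausdorff abelian group, written multiplicatively, with Haar measure $\mu$ (a Radon measure), and let $K_1, K_2$ be uniform lattices in $G$, i.e. discrete subgroups with $G/K_1$ and $G/K_2$ compact. For $i=1,2$ let $|G/K_i|$ be the total mass of the Haar measure $\nu_i$ on $G/K_i$ normalized by Weil's formula $\int_G f\,d\mu=\int_{G/K_i}\sum_{k\in K_i}f(xk)\,d\nu_i(xK_i)$ for all continuous compactly supported $f$ on $G$. Let $Ann(K_2)=\{\gamma\in\hat G:\gamma(k)=1\ \forall k\in K_2\}$ and, for $g\in L^2(G)=L^2(G,\mu)$, $k_1\in K_1$ and $\gamma_2\in Ann(K_2)$, let $(\gamma_2T_{k_1}g)(t)=\gamma_2(t)\,g(tk_1^{-1})$. A family $\{f_i\}_{i\in I}$ in a Hilbert space $\mathcal H$ is a frame for $\mathcal H$ if there are constants $A,B>0$ with $A\|f\|^2\le\sum_{i\in I}|\langle f,f_i\rangle|^2\le B\|f\|^2$ for all $f\in\mathcal H$; it is a Riesz basis for $\mathcal H$ if $f_i=Ue_i$ for all $i\in I$, where $\{e_i\}_{i\in I}$ is an orthonormal basis of $\mathcal H$ and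 $U:\mathcal H\to\mathcal H$ is a bounded bijective linear operator. Let $g\in L^2(G)$. Then the following hold. (i) If $\dfrac{|G/K_1|}{|G/K_2|}>1$, then $\{\gamma_2T_{k_1}g\}_{(k_1,\gamma_2)\in K_1\times Ann(K_2)}$ is not a frame for $L^2(G)$. (ii) If $\{\gamma_2T_{k_1}g\}_{(k_1,\gamma_2)\in K_1\times Ann(K_2)}$ is a frame for $L^2(G)$, then $|G/K_1|=|G/K_2|$ if and only if $\{\gamma_2T_{k_1}g\}_{(k_1,\gamma_2)\in K_1\times Ann(K_2)}$ is a Riesz basis for $L^2(G)$. -/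

import Mathlib

open MeasureTheory TopologicalSpace
open scoped ENNReal NNReal

namespace GaborLCA

/-- The indexed family `f` is a frame for the Hilbert space `H`: there are constants `A, B > 0`
with `A ‖h‖² ≤ ∑ |⟨h, f i⟩|² ≤ B ‖h‖²` for all `h` (the series being convergent). -/
def IsFrame {ι H : Type*} [NormedAddCommGroup H] [InnerProductSpace ℂ H] (f : ι → H) : Prop :=
  ∃ A B : ℝ, 0 < A ∧ 0 < B ∧ ∀ h : H,
    Summable (fun i => ‖inner ℂ h (f i)‖ ^ 2) ∧
    A * ‖h‖ ^ 2 ≤ ∑' i, ‖inner ℂ h (f i)‖ ^ 2 ∧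
    ∑' i, ‖inner ℂ h (f i)‖ ^ 2 ≤ B * ‖h‖ ^ 2

/-- The indexed family `f` is a Riesz basis of `H`: the image of an orthonormal (Hilbert) basis
under a bounded bijective operator. -/
def IsRieszBasis {ι H : Type*} [NormedAddCommGroup H] [InnerProductSpace ℂ H]
    (f : ι → H) : Prop :=
  ∃ (e : HilbertBasis ι ℂ H) (U : H →L[ℂ] H), Function.Bijective U ∧ ∀ i, f i = U (e i)

section Group

variable {G : Type*} [CommGroup G] [TopologicalSpace G] [IsTopologicalGroup G]

/-- The annihilator of a subgroup `K`: the characters of `G` that are trivial on `K`. -/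
def annihilator (K : Subgroup G) : Subgroup (PontryaginDual G) where
  carrier := {γ | ∀ k ∈ K, γ k = 1}
  one_mem' := fun _ _ => rfl
  mul_mem' := by
    intro a b ha hb k hk
    have h : (a * b) k = a k * b k := rfl
    rw [h, ha k hk, hb k hk, one_mul]
  inv_mem' := by
    intro a ha k hk
    have h : a⁻¹ k = (a k)⁻¹ := rfl
    rw [h, ha k hk, inv_one]

theorem isSES_quotient [T2Space G] (K : Subgroup G) [DiscreteTopology K] :
    TopologicalGroup.IsSES K.subtype (QuotientGroup.mk' K) :=
  TopologicalGroup.IsSES.ofClosedSubgroup K Subgroup.isClosed_of_discrete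

variable [MeasurableSpace G] [BorelSpace G]

theorem memLp_modTrans (μ : Measure G) [μ.IsHaarMeasure] (x : G) (γ : PontryaginDual G)
    (g : Lp ℂ 2 μ) : MemLp (fun t : G => (γ t : ℂ) * g (t * x⁻¹)) 2 μ := by
  have h1 : MemLp (fun t : G => g (t * x⁻¹)) 2 μ :=
    (Lp.memLp g).comp_measurePreserving (measurePreserving_mul_right μ x⁻¹)
  have hc : Continuous (fun t : G => (γ t : ℂ)) :=
    continuous_subtype_val.comp (map_continuous γ)
  refine h1.of_le (hc.aestronglyMeasurable.mul h1.1) ?_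
  filter_upwards with t
  rw [norm_mul, Circle.norm_coe, one_mul]

/-- The time-frequency shift `γ T_x g`, that is `t ↦ γ(t) g(t x⁻¹)`, of `g ∈ L²(G)`. -/
noncomputable def modTrans (μ : Measure G) [μ.IsHaarMeasure] (x : G) (γ : PontryaginDual G)
    (g : Lp ℂ 2 μ) : Lp ℂ 2 μ :=
  (memLp_modTrans μ x γ g).toLp _

/-- The generalized Gabor system `{γ₂ T_{k₁} g}` indexed by `(k₁, γ₂) ∈ K₁ × Ann(K₂)`. -/
noncomputable def gaborSystem (μ : Measure G) [μ.IsHaarMeasure] (K₁ K₂ : Subgroup G)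
    (g : Lp ℂ 2 μ) : K₁ × annihilator K₂ → Lp ℂ 2 μ :=
  fun p => modTrans μ (p.1 : G) (p.2 : PontryaginDual G) g

section Quotient

variable [T2Space G]

instance isHaarMeasure_count (K : Subgroup G) [DiscreteTopology K] :
    (Measure.count : Measure K).IsHaarMeasure where
  lt_top_of_isCompact C hC := by
    have hf : C.Finite := hC.finite_of_discrete
    exact Measure.count_apply_lt_top.2 hf
  map_mul_left_eq_self k := by
    ext s hs
    rw [Measure.map_apply (measurable_const_mul k) hs]
    have e : (fun x => k * x) ⁻¹' s = (Equiv.mulLeft k).symm '' s := by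
      rw [Equiv.image_eq_preimage_symm]; rfl
    rw [e, Measure.count_injective_image (Equiv.mulLeft k).symm.injective]
  open_pos U _ hU := by
    rw [Measure.count_ne_zero_iff]
    exact hU

variable [LocallyCompactSpace G]

/-- The quotient Haar measure on `G ⧸ K` for a uniform lattice `K` and a Haar measure `μ` of `G`:
the Haar measure `ν` of `G ⧸ K` for which Weil's formula
`∫_G f dμ = ∫_{G ⧸ K} ∑_{k ∈ K} f (x k) dν` holds (see `integral_quotientMeasure`).
`G ⧸ K` carries its Borel σ-algebra. It is built by rescaling the Haar probability measure of
`G ⧸ K`, through the Haar measure on `G` that this probability measure and the counting measure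
of `K` induce. -/
noncomputable def quotientMeasure (μ : Measure G) [μ.IsHaarMeasure] (K : Subgroup G)
    [DiscreteTopology K] [CompactSpace (G ⧸ K)] : @Measure (G ⧸ K) (borel (G ⧸ K)) :=
  letI : MeasurableSpace (G ⧸ K) := borel (G ⧸ K)
  haveI : BorelSpace (G ⧸ K) := ⟨rfl⟩
  let ν₀ : Measure (G ⧸ K) := Measure.haarMeasure ⊤
  μ.haarScalarFactor ((isSES_quotient K).inducedMeasure Measure.count ν₀) • ν₀

/-- Weil's formula, which characterizes `quotientMeasure μ K` among the Haar measures. -/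
theorem integral_quotientMeasure (μ : Measure G) [μ.IsHaarMeasure] [μ.Regular] (K : Subgroup G)
    [DiscreteTopology K] [CompactSpace (G ⧸ K)] (f : CompactlySupportedContinuousMap G ℝ) :
    ∫ x, f x ∂μ =
      @integral (G ⧸ K) ℝ _ _ (borel (G ⧸ K)) (quotientMeasure μ K)
        (fun q => ∑' k : K, f (q.out * k)) := by
  let : MeasurableSpace (G ⧸ K) := borel (G ⧸ K)
  have : BorelSpace (G ⧸ K) := ⟨rfl⟩
  have H := isSES_quotient K
  let ν₀ : Measure (G ⧸ K) := Measure.haarMeasure ⊤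
  have key (q : G ⧸ K) : H.pushforward Measure.count f q = ∑' k : K, f (q.out * k) := by
    have hq : QuotientGroup.mk' K q.out = q := QuotientGroup.out_eq' q
    conv_lhs => rw [← hq]
    rw [H.pushforward_apply_apply]
    set φ := H.pullback f q.out with hφ
    have hfin : (Function.support φ).Finite := by
      obtain ⟨C, hC, h0⟩ := exists_compact_iff_hasCompactSupport.mpr φ.hasCompactSupport
      refine hC.finite_of_discrete.subset fun x hx => ?_
      by_contra hxC
      exact hx (h0 x hxC)
    have h1 : ∫ a, φ a ∂(Measure.count : Measure K) = ∑' a, φ a := by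
      rw [← setIntegral_support, tsum_eq_sum (s := hfin.toFinset) (by simp)]
      have := setIntegral_finset (μ := (Measure.count : Measure K)) hfin.toFinset
        (f := fun a => φ a) φ.integrable.integrableOn
      rw [hfin.coe_toFinset] at this
      rw [this]
      simp [Measure.real]
    rw [h1]
    rfl
  change _ = ∫ q, (∑' k : K, f (q.out * k)) ∂(quotientMeasure μ K)
  simp_rw [← key]
  have h2 : quotientMeasure μ K =
      μ.haarScalarFactor (H.inducedMeasure Measure.count ν₀) • ν₀ := rfl
  rw [h2, integral_smul_nnreal_measure, ← H.integrate_apply, ← H.integral_inducedMeasure,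
    ← integral_smul_nnreal_measure, ← Measure.isMulLeftInvariant_eq_smul_of_regular]

/-- `|G/K|`: the total mass of the quotient Haar measure (a finite positive number). -/
noncomputable def quotientVolume (μ : Measure G) [μ.IsHaarMeasure] (K : Subgroup G)
    [DiscreteTopology K] [CompactSpace (G ⧸ K)] : ℝ :=
  (quotientMeasure μ K Set.univ).toReal

theorem quotientVolume_pos (μ : Measure G) [μ.IsHaarMeasure] (K : Subgroup G)
    [DiscreteTopology K] [CompactSpace (G ⧸ K)] : 0 < quotientVolume μ K := by
  let : MeasurableSpace (G ⧸ K) := borel (G ⧸ K)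
  have : BorelSpace (G ⧸ K) := ⟨rfl⟩
  let ν₀ : Measure (G ⧸ K) := Measure.haarMeasure ⊤
  have h1 : ν₀ Set.univ = 1 := Measure.haarMeasure_self
  have h2 : quotientVolume μ K =
      μ.haarScalarFactor ((isSES_quotient K).inducedMeasure Measure.count ν₀) := by
    change ((_ • ν₀) Set.univ).toReal = _
    rw [Measure.smul_apply, h1]
    simp [ν₀, ENNReal.smul_def]
  rw [h2]
  exact_mod_cast Measure.haarScalarFactor_pos_of_isHaarMeasure _ _

end Quotient

end Group

end GaborLCA

set_option linter.overlappingInstances false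
set_option linter.unusedSectionVars false

namespace GaborLCA

/-! ### Characters obtained from commuting unitaries by Gelfand theory. -/

section UnitaryRepresentation

variable {A H : Type*} [CommGroup H] [TopologicalSpace H] [IsTopologicalGroup H]

/-! If `g` generates a frame with frame operator `S`, then `S` commutes with the time-frequency
shifts, so `h = S^(-1/2) g` generates a Parseval frame (`exists_parseval_window`). Everything then
follows from `|G/K₁| = |G/K₂| ‖h‖²`: members of a Parseval frame have norm at most 1, which gives
(i). For (ii), a Parseval frame is a Riesz basis exactly when all its members are unit vectors, and
`S^(1/2)` carries the system of `h` to that of `g`.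

For the volume identity (`quotientVolume_eq_mul_norm_sq_of_parseval`), take finitely many test
functions `f i` in `C_c(G)` whose squares, summed over `i` and over `K₁`-translates, give 1, each
meeting every coset of `K₂` at most once. Evaluate `∑ |⟨f i, γ T_k h⟩|²` over all `i, k, γ` in two
ways. Parseval for `h` gives `∑ ‖f i‖² = |G/K₁|` by Weil's formula. Parseval on `G/K₂`, whose dual
is `Ann(K₂)`, turns the sum over `γ` into `|G/K₂| ∫ |f i · T_k h|²`, and these add up to `|G/K₂|
‖h‖²`.

Parseval on a compact abelian group requires that characters separate points; they are found in the
Gelfand spectrum of an algebra generated by translations and one convolution operator. -/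

theorem exists_character_apply_ne_one_of_comm [CommCStarAlgebra A] (L : H →* unitary A) (T : A)
    (hc : Continuous fun x => (L x : A) * T) (x₀ : H)
    (hx₀ : (L x₀ : A) * T ≠ T) : ∃ χ : PontryaginDual H, χ x₀ ≠ 1 := by
  obtain ⟨ψ, hψ⟩ : ∃ ψ : WeakDual.characterSpace ℂ A, ψ ((L x₀ : A) * T - T) ≠ 0 := by
    by_contra! h
    refine hx₀ (sub_eq_zero.1 ((gelfandTransform_isometry A).injective ?_))
    ext ψ
    simpa using! h ψ
  have hT : ψ T ≠ 0 := by
    intro h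
    simp [map_sub, map_mul, h] at hψ
  have hnorm : ∀ x, ψ (L x : A) ∈ Submonoid.unitSphere ℂ := fun x => by
    have h1 : ψ (star (L x : A) * L x) = 1 := by simp
    rw [map_mul, map_star, Complex.star_def, ← Complex.normSq_eq_conj_mul_self] at h1
    rw [Submonoid.unitSphere, Submonoid.mem_mk, Subsemigroup.mem_mk,
      mem_sphere_zero_iff_norm]
    have h2 : Complex.normSq (ψ (L x : A)) = 1 := by exact_mod_cast h1
    rw [Complex.normSq_eq_norm_sq] at h2
    exact (pow_eq_one_iff_of_nonneg (norm_nonneg _) two_ne_zero).1 h2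
  let χ : H →* Circle :=
    { toFun := fun x => ⟨ψ (L x : A), hnorm x⟩
      map_one' := by ext; simp
      map_mul' := fun x y => by ext; simp; rfl }
  have hχ : Continuous χ := by
    -- `x ↦ L x` need not be norm continuous, but `x ↦ L x * T` is; dividing by `ψ T ≠ 0` recovers
    -- `ψ (L x)`.
    refine Continuous.subtype_mk ?_ _
    have h1 : Continuous fun x => ψ ((L x : A) * T) / ψ T :=
      ((map_continuous ψ).comp hc).div_const _
    refine h1.congr fun x => ?_
    rw [map_mul, mul_div_cancel_right₀ _ hT]
  refine ⟨(⟨χ, hχ⟩ : H →ₜ* Circle), fun h => hψ ?_⟩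
  have h1 : ψ (L x₀ : A) = 1 := congrArg (fun z : Circle => (z : ℂ)) h
  rw [map_sub, map_mul, h1, one_mul, sub_self]

/-- The `L x` and `T` commute with one another and with all their adjoints, so the closed star
subalgebra they generate is commutative, which reduces to the previous case. -/
theorem exists_character_apply_ne_one [CStarAlgebra A] (L : H →* unitary A) (T : A)
    [hT : IsStarNormal T]
    (hLT : ∀ x, (L x : A) * T = T * L x) (hc : Continuous fun x => (L x : A) * T) (x₀ : H)
    (hx₀ : (L x₀ : A) * T ≠ T) : ∃ χ : PontryaginDual H, χ x₀ ≠ 1 := by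
  have hstar : ∀ x, star (L x : A) = L x⁻¹ := fun x => by
    rw [map_inv, ← Unitary.star_eq_inv, Unitary.coe_star]
  have hLL : ∀ x y, (L x : A) * L y = L y * L x := fun x y => by
    rw [← Submonoid.coe_mul, ← Submonoid.coe_mul, ← map_mul, ← map_mul, mul_comm]
  have hLT' : ∀ x, (L x : A) * star T = star T * L x := fun x => by
    have := congrArg star (hLT x⁻¹)
    rw [star_mul, star_mul, hstar, inv_inv] at this
    exact this.symm
  let s : Set A := insert T (Set.range fun x => (L x : A))
  have h1 : ∀ a ∈ s, ∀ b ∈ s, a * b = b * a := by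
    rintro a (rfl | ⟨x, rfl⟩) b (rfl | ⟨y, rfl⟩)
    exacts [rfl, (hLT y).symm, hLT x, hLL x y]
  have h2 : ∀ a ∈ s, ∀ b ∈ s, a * star b = star b * a := by
    rintro a (rfl | ⟨x, rfl⟩) b (rfl | ⟨y, rfl⟩)
    · exact hT.star_comm_self.eq.symm
    · simp only [hstar]; exact (hLT _).symm
    · exact hLT' x
    · simp only [hstar]; exact hLL _ _
  have hcomm := StarAlgebra.isMulCommutative_adjoin ℂ h1 h2
  let S : StarSubalgebra ℂ A := (StarAlgebra.adjoin ℂ s).topologicalClosure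
  have hSc : IsClosed (S : Set A) := isClosed_closure
  have hSm : ∀ x y : S, x * y = y * x :=
    (StarSubalgebra.commRingTopologicalClosure _ fun x y => mul_comm' x y).mul_comm
  let _ : CommCStarAlgebra S := { (inferInstance : CStarAlgebra S) with mul_comm := hSm }
  have hsS : s ⊆ S := (StarAlgebra.subset_adjoin ℂ s).trans
    (StarSubalgebra.le_topologicalClosure _)
  have hL : ∀ x, (L x : A) ∈ S := fun x => hsS (Or.inr ⟨x, rfl⟩)
  let L' : H →* unitary S :=
    { toFun := fun x => ⟨⟨L x, hL x⟩, by
        rw [Unitary.mem_iff]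
        exact ⟨Subtype.ext (Unitary.star_mul_self_of_mem (L x).2),
          Subtype.ext (Unitary.mul_star_self_of_mem (L x).2)⟩⟩
      map_one' := by ext; simp
      map_mul' := fun x y => by ext; simp }
  refine exists_character_apply_ne_one_of_comm (A := S) L' ⟨T, hsS (Or.inl rfl)⟩
    (hc.subtype_mk _) x₀ fun h => hx₀ (congrArg Subtype.val h)

end UnitaryRepresentation

/-! ### Translations and convolutions on `L²` of a compact group. -/

section Compact

variable {H : Type*} [CommGroup H] [TopologicalSpace H] [IsTopologicalGroup H] [T2Space H]
  [CompactSpace H] [MeasurableSpace H] [BorelSpace H]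

/-- The unitary representation of `H` on `L²(H)` by translations. -/
noncomputable def translation (ν : Measure H) [ν.IsHaarMeasure] :
    H →* (Lp ℂ 2 ν ≃ₗᵢ[ℂ] Lp ℂ 2 ν) where
  toFun x :=
    { toFun := fun f => DomMulAct.mk x • f
      invFun := fun f => DomMulAct.mk x⁻¹ • f
      map_add' := fun f g => smul_add _ f g
      map_smul' := fun c f => smul_comm (DomMulAct.mk x) c f
      left_inv := fun f => inv_smul_smul (DomMulAct.mk x) f
      right_inv := fun f => smul_inv_smul (DomMulAct.mk x) f
      norm_map' := fun f => DomMulAct.norm_smul_Lp _ f }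
  map_one' := by ext f : 1; exact one_smul (DomMulAct H) f
  map_mul' x y := by
    ext f : 1
    change DomMulAct.mk (x * y) • f = DomMulAct.mk x • DomMulAct.mk y • f
    rw [smul_smul, ← DomMulAct.mk_mul, mul_comm]

theorem translation_toLp (ν : Measure H) [ν.IsHaarMeasure] (x : H) (F : C(H, ℂ)) :
    translation ν x (ContinuousMap.toLp 2 ν ℂ F) =
      ContinuousMap.toLp 2 ν ℂ (F.comp (ContinuousMap.mulLeft x)) := rfl

variable (ν : Measure H) [ν.IsHaarMeasure] [ν.Regular]

theorem continuous_translation_apply (f : Lp ℂ 2 ν) : Continuous fun x => translation ν x f :=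
  have : Fact ((2 : ℝ≥0∞) ≠ ∞) := ⟨by simp⟩
  (continuous_id.smul continuous_const).comp DomMulAct.continuous_mk

theorem integrable_smul_translation (φ : C(H, ℂ)) (f : Lp ℂ 2 ν) :
    Integrable (fun y => φ y • translation ν y f) ν :=
  ((map_continuous φ).smul (continuous_translation_apply ν f)).integrable_of_hasCompactSupport
    (HasCompactSupport.of_compactSpace _)

/-- The operators `f ↦ ∫ φ(y) L_y f dν(y)` on `L²(H)` for the translation representation `L`. -/
noncomputable def averaging : C(H, ℂ) →L[ℂ] Lp ℂ 2 ν →L[ℂ] Lp ℂ 2 ν :=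
  LinearMap.mkContinuous₂
    (LinearMap.mk₂ ℂ (fun φ f => ∫ y, φ y • translation ν y f ∂ν)
      (fun φ φ' f => by
        rw [← integral_add (integrable_smul_translation ν φ f) (integrable_smul_translation ν φ' f)]
        simp only [ContinuousMap.add_apply, add_smul])
      (fun c φ f => by
        rw [← integral_smul]
        simp only [ContinuousMap.smul_apply, smul_assoc])
      (fun φ f f' => by
        rw [← integral_add (integrable_smul_translation ν φ f) (integrable_smul_translation ν φ f')]
        simp only [map_add, smul_add])
      (fun c φ f => by
        rw [← integral_smul]
        simp only [map_smul, smul_comm c]))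
    (ν.real Set.univ) (fun φ f => by
      refine (norm_integral_le_of_norm_le_const (C := ‖φ‖ * ‖f‖) (.of_forall fun y => ?_)).trans ?_
      · rw [norm_smul, LinearIsometryEquiv.norm_map]
        gcongr
        exact φ.norm_coe_le_norm y
      · rw [mul_comm, mul_assoc])

theorem averaging_apply (φ : C(H, ℂ)) (f : Lp ℂ 2 ν) :
    averaging ν φ f = ∫ y, φ y • translation ν y f ∂ν := rfl

theorem commute_averaging (S : Lp ℂ 2 ν →L[ℂ] Lp ℂ 2 ν)
    (hS : ∀ x f, S (translation ν x f) = translation ν x (S f)) (φ : C(H, ℂ)) :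
    S * averaging ν φ = averaging ν φ * S := by
  ext1 f
  change S (averaging ν φ f) = averaging ν φ (S f)
  rw [averaging_apply, averaging_apply,
    ← S.integral_comp_comm (integrable_smul_translation ν φ f)]
  simp only [map_smul, hS]

/-- By invariance of `ν`, the translation can be absorbed into `φ`, whose translates vary
continuously in sup norm. This is the source of norm continuity of `x ↦ L x * T`. -/
theorem translation_averaging (φ : C(H, ℂ)) (x : H) (f : Lp ℂ 2 ν) :
    translation ν x (averaging ν φ f) = averaging ν (φ.comp (ContinuousMap.mulLeft x⁻¹)) f := by
  rw [averaging_apply, averaging_apply]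
  have h1 := (translation ν x : Lp ℂ 2 ν ≃L[ℂ] Lp ℂ 2 ν).integral_comp_comm (μ := ν)
    (fun y => φ y • translation ν y f)
  have h2 := integral_mul_left_eq_self (μ := ν)
    (fun y => φ (x⁻¹ * y) • translation ν y f) x
  refine (h1.symm.trans ?_).trans h2
  refine integral_congr_ae (.of_forall fun y => ?_)
  simp [map_mul]

theorem exists_translation_ne {x : H} (hx : x ≠ 1) : ∃ f : Lp ℂ 2 ν, translation ν x f ≠ f := by
  obtain ⟨F, h0, h1, -⟩ := exists_continuous_zero_one_of_isClosed (isClosed_singleton (x := x))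
    (isClosed_singleton (x := (1 : H))) (by simpa using hx)
  let F' : C(H, ℂ) := ⟨fun y => (F y : ℂ), by fun_prop⟩
  refine ⟨ContinuousMap.toLp 2 ν ℂ F', fun h => ?_⟩
  rw [translation_toLp] at h
  have h2 := congrArg (fun f : C(H, ℂ) => f 1) (ContinuousMap.toLp_injective ν h)
  have h3 : F x = 0 := h0 rfl
  have h4 : F 1 = 1 := h1 rfl
  simp [F', h3, h4] at h2

/-- The characters of a compact Hausdorff abelian group separate points. -/
theorem exists_pontryaginDual_apply_ne_one {x₀ : H} (hx₀ : x₀ ≠ 1) :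
    ∃ χ : PontryaginDual H, χ x₀ ≠ 1 := by
  let ν : Measure H := Measure.haarMeasure ⊤
  obtain ⟨f, hf⟩ := exists_translation_ne ν hx₀
  let g := translation ν x₀ f - f
  have hg : g ≠ 0 := sub_ne_zero.2 hf
  -- With this kernel `⟨g, averaging ν φ g⟩ = ∫ |φ|²`, positive because `φ 1 = ‖g‖²`. So the
  -- averaging operator does not kill `g`, the difference of `f` and its translate.
  let φ : C(H, ℂ) := ⟨fun y => inner ℂ (translation ν y g) g,
    (continuous_translation_apply ν g).inner continuous_const⟩
  have hφ : ∀ y, φ y = inner ℂ (translation ν y g) g := fun _ => rfl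
  let L : H →* unitary (Lp ℂ 2 ν →L[ℂ] Lp ℂ 2 ν) :=
    Unitary.linearIsometryEquiv.symm.toMonoidHom.comp (translation ν)
  have hLL : ∀ x y f, translation ν x (translation ν y f) = translation ν y (translation ν x f) := by
    intro x y f
    have := congrArg (fun e => e f) ((translation ν).map_mul x y)
    have h2 := congrArg (fun e => e f) ((translation ν).map_mul y x)
    rw [mul_comm] at h2
    exact this.symm.trans h2
  have hLT : ∀ x, (L x : Lp ℂ 2 ν →L[ℂ] Lp ℂ 2 ν) * averaging ν φ = averaging ν φ * L x := fun x =>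
    commute_averaging ν _ (fun y f => hLL x y f) φ
  have hne : translation ν x₀ (averaging ν φ f) ≠ averaging ν φ f := by
    intro h
    have h0 : averaging ν φ (translation ν x₀ f) = averaging ν φ f :=
      (congrArg (fun S : Lp ℂ 2 ν →L[ℂ] Lp ℂ 2 ν => S f) (hLT x₀)).symm.trans h
    have h1 : averaging ν φ g = 0 := by
      rw [map_sub, h0, sub_self]
    have h2 : ∫ y, ‖φ y‖ ^ 2 ∂ν = 0 := by
      have h3 : inner ℂ g (averaging ν φ g) = ∫ y, ((‖φ y‖ ^ 2 : ℝ) : ℂ) ∂ν := by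
        rw [averaging_apply, ← integral_inner (integrable_smul_translation ν φ g)]
        refine integral_congr_ae (.of_forall fun y => ?_)
        simp only
        rw [inner_smul_right, ← inner_conj_symm, ← hφ, Complex.mul_conj,
          Complex.normSq_eq_norm_sq]
      rw [h1, inner_zero_right, integral_complex_ofReal] at h3
      exact_mod_cast h3.symm
    have h4 : Continuous fun y => ‖φ y‖ ^ 2 := by fun_prop
    refine (h4.integral_pos_of_hasCompactSupport_nonneg_nonzero (μ := ν) (x := 1)
      (HasCompactSupport.of_compactSpace _) (fun y => by positivity) ?_).ne' h2
    rw [hφ, map_one]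
    simpa using hg
  have hstar : ∀ x, star (L x : Lp ℂ 2 ν →L[ℂ] Lp ℂ 2 ν) = L x⁻¹ := fun x => by
    rw [map_inv, ← Unitary.star_eq_inv, Unitary.coe_star]
  -- The adjoint also commutes with translations, hence with every average of them.
  have hT : IsStarNormal (averaging ν φ) := by
    refine ⟨commute_averaging ν (star (averaging ν φ)) (fun x f => ?_) φ⟩
    have := congrArg star (hLT x⁻¹)
    rw [star_mul, star_mul, hstar, inv_inv] at this
    exact congrArg (fun S : Lp ℂ 2 ν →L[ℂ] Lp ℂ 2 ν => S f) this
  refine exists_character_apply_ne_one L (averaging ν φ) hLT ?_ x₀ fun h =>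
    hne (congrArg (fun S : Lp ℂ 2 ν →L[ℂ] Lp ℂ 2 ν => S f) h)
  have hshift : Continuous fun x : H => φ.comp (ContinuousMap.mulLeft x⁻¹) := by
    refine ContinuousMap.continuous_of_continuous_uncurry _ ?_
    change Continuous fun p : H × H => φ (p.1⁻¹ * p.2)
    fun_prop
  refine ((averaging ν).continuous.comp hshift).congr fun x => ?_
  ext1 f
  exact (translation_averaging ν φ x f).symm

end Compact
-- Density of characters and Parseval on a compact group.
theorem _root_.HilbertBasis.hasSum_norm_sq_inner {ι E : Type*} [NormedAddCommGroup E]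
    [InnerProductSpace ℂ E] (b : HilbertBasis ι ℂ E) (x : E) :
    HasSum (fun i => ‖inner ℂ x (b i)‖ ^ 2) (‖x‖ ^ 2) := by
  have h := b.hasSum_inner_mul_inner x x
  have h1 : inner ℂ x x = ((‖x‖ ^ 2 : ℝ) : ℂ) := by
    rw [Complex.ofReal_pow]; exact inner_self_eq_norm_sq_to_K x
  rw [h1] at h
  have h2 : ∀ i, inner ℂ x (b i) * inner ℂ (b i) x = ((‖inner ℂ x (b i)‖ ^ 2 : ℝ) : ℂ) := by
    intro i
    rw [← inner_conj_symm (b i) x, Complex.mul_conj, Complex.normSq_eq_norm_sq]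
  simp_rw [h2] at h
  exact Complex.hasSum_ofReal.1 h

section Compact

variable {H : Type*} [CommGroup H] [TopologicalSpace H] [IsTopologicalGroup H]

/-- Characters as continuous complex-valued functions. -/
noncomputable def characterMap : PontryaginDual H →* C(H, ℂ) where
  toFun χ := ⟨fun x => (χ x : ℂ), continuous_subtype_val.comp (map_continuous χ)⟩
  map_one' := rfl
  map_mul' χ χ' := by ext x; exact Circle.coe_mul (χ x) (χ' x)

@[simp] theorem characterMap_apply (χ : PontryaginDual H) (x : H) :
    characterMap χ x = (χ x : ℂ) := rfl

theorem star_characterMap (χ : PontryaginDual H) :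
    star (characterMap χ) = characterMap χ⁻¹ := by
  ext x
  exact (Circle.coe_inv_eq_conj (χ x)).symm

variable [CompactSpace H]

/-- The star subalgebra of `C(H, ℂ)` spanned by the characters. -/
noncomputable def characterSubalgebra (H : Type*) [CommGroup H] [TopologicalSpace H] [IsTopologicalGroup H]
    [CompactSpace H] : StarSubalgebra ℂ C(H, ℂ) where
  toSubalgebra := Algebra.adjoin ℂ (Set.range (characterMap (H := H)))
  star_mem' := by
    change Algebra.adjoin ℂ (Set.range (characterMap (H := H))) ≤
      star (Algebra.adjoin ℂ (Set.range (characterMap (H := H))))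
    refine Algebra.adjoin_le ?_
    rintro - ⟨χ, rfl⟩
    refine Algebra.subset_adjoin ⟨χ⁻¹, (star_characterMap χ).symm⟩

/-- Characters are closed under multiplication, so their linear span is already an algebra and
Stone–Weierstrass applies to it. -/
theorem span_characterMap_eq :
    Submodule.span ℂ (Set.range (characterMap (H := H))) =
      Subalgebra.toSubmodule (characterSubalgebra H).toSubalgebra := by
  refine (Algebra.adjoin_eq_span_of_subset ℂ ?_).symm
  rw [← MonoidHom.coe_mrange, Submonoid.closure_eq]
  exact Submodule.subset_span

variable [T2Space H]

theorem characterSubalgebra_separatesPoints : (characterSubalgebra H).SeparatesPoints := by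
  borelize H
  intro x y hxy
  obtain ⟨χ, hχ⟩ := exists_pontryaginDual_apply_ne_one (div_ne_one.2 hxy)
  refine ⟨characterMap χ, ⟨characterMap χ, Algebra.subset_adjoin ⟨χ, rfl⟩, rfl⟩, fun h => hχ ?_⟩
  rw [map_div, div_eq_one]
  exact Subtype.ext h

theorem span_characterMap_closure_eq_top :
    (Submodule.span ℂ (Set.range (characterMap (H := H)))).topologicalClosure = ⊤ := by
  rw [span_characterMap_eq]
  exact congr_arg (fun S : StarSubalgebra ℂ C(H, ℂ) => Subalgebra.toSubmodule S.toSubalgebra)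
    (ContinuousMap.starSubalgebra_topologicalClosure_eq_top_of_separatesPoints _
      characterSubalgebra_separatesPoints)

variable [MeasurableSpace H] [BorelSpace H] (ν : Measure H) [ν.IsHaarMeasure]

theorem integral_character_eq_zero {χ : PontryaginDual H} (hχ : χ ≠ 1) :
    ∫ x, (χ x : ℂ) ∂ν = 0 := by
  obtain ⟨y, hy⟩ : ∃ y, χ y ≠ 1 := by
    by_contra! h
    exact hχ (PontryaginDual.ext h)
  have h := integral_mul_left_eq_self (μ := ν) (fun x => (χ x : ℂ)) y
  simp only [map_mul, Circle.coe_mul, integral_const_mul] at h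
  by_contra h0
  exact hy (Subtype.ext (mul_right_cancel₀ h0 (h.trans (one_mul _).symm)))

theorem orthonormal_characters [IsProbabilityMeasure ν] :
    Orthonormal ℂ fun χ : PontryaginDual H => ContinuousMap.toLp 2 ν ℂ (characterMap χ) := by
  classical
  rw [orthonormal_iff_ite]
  intro χ χ'
  rw [ContinuousMap.inner_toLp]
  have h : ∀ x, characterMap χ' x * (starRingEnd ℂ) (characterMap χ x) =
      ((χ' * χ⁻¹ : PontryaginDual H) x : ℂ) := by
    intro x
    have := congrArg (fun f => f x) (map_mul characterMap χ' χ⁻¹)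
    rw [← star_characterMap] at this
    exact this.symm
  simp_rw [h]
  split_ifs with hχ
  · subst hχ; simp
  · exact integral_character_eq_zero ν (by rwa [ne_eq, mul_inv_eq_one, eq_comm])

/-- Parseval's identity on a compact Hausdorff abelian group. -/
theorem hasSum_norm_sq_integral_character [ν.Regular] [IsProbabilityMeasure ν] (F : C(H, ℂ)) :
    HasSum (fun χ : PontryaginDual H => ‖∫ x, (χ x : ℂ) * F x ∂ν‖ ^ 2)
      (∫ x, ‖F x‖ ^ 2 ∂ν) := by
  have hd : (Submodule.span ℂ (Set.range fun χ : PontryaginDual H =>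
      ContinuousMap.toLp 2 ν ℂ (characterMap χ))).topologicalClosure = ⊤ := by
    convert! (ContinuousMap.toLp_denseRange ℂ ν ℂ (p := 2)
      (by simp)).topologicalClosure_map_submodule
      (span_characterMap_closure_eq_top (H := H))
    rw [Submodule.map_span, ← Set.range_comp]
    rfl
  let b := HilbertBasis.mk (orthonormal_characters ν) hd.ge
  -- The conjugate of `F` compensates for conjugate linearity in the first slot, so the coefficients
  -- become `∫ χ F`.
  have h := b.hasSum_norm_sq_inner (ContinuousMap.toLp 2 ν ℂ (star F))
  have h2 : ‖ContinuousMap.toLp 2 ν ℂ (star F)‖ ^ 2 = ∫ x, ‖F x‖ ^ 2 ∂ν := by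
    have h3 := ContinuousMap.inner_toLp (𝕜 := ℂ) ν (star F) (star F)
    have h5 := inner_self_eq_norm_sq_to_K (𝕜 := ℂ) (ContinuousMap.toLp 2 ν ℂ (star F))
    rw [h3] at h5
    have h4 : ∀ x, (star F) x * (starRingEnd ℂ) ((star F) x) = ((‖F x‖ ^ 2 : ℝ) : ℂ) := by
      intro x
      rw [Complex.mul_conj, Complex.normSq_eq_norm_sq, ContinuousMap.star_apply, norm_star]
    simp_rw [h4, integral_complex_ofReal] at h5
    refine Complex.ofReal_injective ?_
    rw [Complex.ofReal_pow]
    exact h5.symm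
  rw [h2] at h
  have hb : ∀ χ, b χ = ContinuousMap.toLp 2 ν ℂ (characterMap χ) :=
    congrFun (HilbertBasis.coe_mk (orthonormal_characters ν) hd.ge)
  simp_rw [hb, ContinuousMap.inner_toLp, ContinuousMap.star_apply, Complex.star_def,
    Complex.conj_conj, characterMap_apply] at h
  exact h

end Compact

/-! ### Weil's formula and Parseval along a uniform lattice. -/

section Periodization

variable {G : Type*} [CommGroup G] [TopologicalSpace G] [IsTopologicalGroup G]

/-- The function `xK ↦ ∑ f (x k)` on `G ⧸ K`. -/
noncomputable def periodization {E : Type*} [NormedAddCommGroup E] (K : Subgroup G) (f : G → E)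
    (q : G ⧸ K) : E :=
  ∑' k : K, f (q.out * k)

theorem periodization_mk {E : Type*} [NormedAddCommGroup E] (K : Subgroup G) (f : G → E) (x : G) :
    periodization K f x = ∑' k : K, f (x * k) := by
  obtain ⟨k, hk⟩ := QuotientGroup.mk_out_eq_mul K x
  rw [periodization, hk, ← (Equiv.mulLeft k).tsum_eq fun k : K => f (x * k)]
  simp [mul_assoc]

theorem finite_support_mul [T2Space G] {E : Type*} [NormedAddCommGroup E] (K : Subgroup G)
    [DiscreteTopology K] {f : G → E} (hs : HasCompactSupport f) (x : G) :
    (Function.support fun k : K => f (x * k)).Finite := by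
  have h : IsCompact ((fun k : K => x * k) ⁻¹' tsupport f) :=
    (((Homeomorph.mulLeft x).isClosedEmbedding.comp
      (Subgroup.isClosed_of_discrete (H := K)).isClosedEmbedding_subtypeVal).isCompact_preimage hs)
  exact h.finite_of_discrete.subset fun k hk => subset_tsupport f hk

variable [T2Space G] [LocallyCompactSpace G] [MeasurableSpace G] [BorelSpace G]

theorem pushforward_count_apply {E : Type*} [NormedAddCommGroup E] [NormedSpace ℝ E]
    [CompleteSpace E] (K : Subgroup G)
    [DiscreteTopology K] (f : CompactlySupportedContinuousMap G E) (q : G ⧸ K) :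
    (isSES_quotient K).pushforward Measure.count f q = periodization K f q := by
  obtain ⟨x, rfl⟩ := QuotientGroup.mk_surjective q
  rw [periodization_mk]
  refine ((isSES_quotient K).pushforward_apply_apply _ f x).trans ?_
  have hfin := finite_support_mul K f.hasCompactSupport x
  change ∫ a : K, f (x * a) ∂Measure.count = _
  rw [← setIntegral_support, tsum_eq_sum (s := hfin.toFinset) (by simp)]
  have := setIntegral_finset (μ := (Measure.count : Measure K)) hfin.toFinset
    (f := fun a : K => f (x * a)) (((isSES_quotient K).pullback f x).integrable.integrableOn)
  rw [hfin.coe_toFinset] at this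
  rw [this]
  simp [Measure.real]

theorem continuous_periodization {E : Type*} [NormedAddCommGroup E] [NormedSpace ℝ E]
    [CompleteSpace E] (K : Subgroup G)
    [DiscreteTopology K] {f : G → E} (hf : Continuous f) (hs : HasCompactSupport f) :
    Continuous (periodization K f) := by
  have h := ((isSES_quotient K).pushforward Measure.count
    (⟨⟨f, hf⟩, hs⟩ : CompactlySupportedContinuousMap G E)).continuous
  exact h.congr (pushforward_count_apply K _)

variable (μ : Measure G) [μ.IsHaarMeasure] [μ.Regular] (K : Subgroup G)
    [DiscreteTopology K] [CompactSpace (G ⧸ K)]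

/-- `quotientMeasure` is a multiple of the Haar probability measure, and the multiple is its total
mass. -/
theorem integral_eq_quotientVolume_mul_real [MeasurableSpace (G ⧸ K)] [BorelSpace (G ⧸ K)]
    {f : G → ℝ} (hf : Continuous f) (hs : HasCompactSupport f) :
    ∫ x, f x ∂μ = quotientVolume μ K *
      ∫ q, periodization K f q ∂(Measure.haarMeasure ⊤ : Measure (G ⧸ K)) := by
  obtain rfl : ‹MeasurableSpace (G ⧸ K)› = borel (G ⧸ K) := BorelSpace.measurable_eq
  let _ : MeasurableSpace (G ⧸ K) := borel (G ⧸ K)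
  have : BorelSpace (G ⧸ K) := ⟨rfl⟩
  have h1 := integral_quotientMeasure μ K (⟨⟨f, hf⟩, hs⟩ : CompactlySupportedContinuousMap G ℝ)
  have h2 : quotientMeasure μ K =
      μ.haarScalarFactor ((isSES_quotient K).inducedMeasure Measure.count
        (Measure.haarMeasure ⊤ : Measure (G ⧸ K))) • (Measure.haarMeasure ⊤ : Measure (G ⧸ K)) :=
    rfl
  have h3 : (Measure.haarMeasure ⊤ : Measure (G ⧸ K)) Set.univ = 1 := Measure.haarMeasure_self
  have h4 : quotientVolume μ K =
      μ.haarScalarFactor ((isSES_quotient K).inducedMeasure Measure.count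
        (Measure.haarMeasure ⊤ : Measure (G ⧸ K))) := by
    rw [quotientVolume, h2, Measure.smul_apply, h3]
    simp [ENNReal.smul_def]
  rw [h4]
  refine h1.trans ?_
  rw [h2, integral_smul_nnreal_measure]
  rfl

theorem integral_eq_quotientVolume_mul [MeasurableSpace (G ⧸ K)] [BorelSpace (G ⧸ K)]
    {f : G → ℂ} (hf : Continuous f) (hs : HasCompactSupport f) :
    ∫ x, f x ∂μ = quotientVolume μ K *
      ∫ q, periodization K f q ∂(Measure.haarMeasure ⊤ : Measure (G ⧸ K)) := by
  have hint : Integrable f μ := hf.integrable_of_hasCompactSupport hs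
  have hint' : Integrable (periodization K f) (Measure.haarMeasure ⊤ : Measure (G ⧸ K)) :=
    (continuous_periodization K hf hs).integrable_of_hasCompactSupport (.of_compactSpace _)
  have key (L : ℂ →L[ℝ] ℝ) : L (∫ x, f x ∂μ) = quotientVolume μ K *
      L (∫ q, periodization K f q ∂(Measure.haarMeasure ⊤ : Measure (G ⧸ K))) := by
    rw [← L.integral_comp_comm hint, ← L.integral_comp_comm hint',
      integral_eq_quotientVolume_mul_real μ K (f := fun x => L (f x)) (by fun_prop)
        (hs.comp_left (map_zero L))]
    congr 2 with q
    exact (L.map_tsum (summable_of_hasFiniteSupport (finite_support_mul K hs _))).symm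
  apply Complex.ext
  · rw [Complex.re_ofReal_mul]; exact key Complex.reCLM
  · rw [Complex.im_ofReal_mul]; exact key Complex.imCLM

/-- Such an `f` plays the part of the indicator of a fundamental domain. -/
theorem integral_eq_quotientVolume {f : G → ℝ} (hf : Continuous f) (hs : HasCompactSupport f)
    (h1 : ∀ x, ∑' k : K, f (x * k) = 1) : ∫ x, f x ∂μ = quotientVolume μ K := by
  borelize (G ⧸ K)
  rw [integral_eq_quotientVolume_mul_real μ K hf hs]
  have h : periodization K f = fun _ => 1 := funext fun q => h1 _
  have h3 : (Measure.haarMeasure ⊤ : Measure (G ⧸ K)) Set.univ = 1 := Measure.haarMeasure_self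
  simp [h, Measure.real, h3]

/-- The characters of `G ⧸ K` are the characters of `G` that are trivial on `K`. -/
noncomputable def annihilatorEquiv {G : Type*} [CommGroup G] [TopologicalSpace G]
    [IsTopologicalGroup G] (K : Subgroup G) : annihilator K ≃ PontryaginDual (G ⧸ K) where
  toFun γ := (⟨QuotientGroup.lift K ((γ : PontryaginDual G) : G →* Circle) γ.2,
    QuotientGroup.isOpenQuotientMap_mk.isQuotientMap.continuous_iff.2 (map_continuous (γ : PontryaginDual G))⟩ :
      (G ⧸ K) →ₜ* Circle)
  invFun χ := ⟨(⟨(χ : (G ⧸ K) →* Circle).comp (QuotientGroup.mk' K),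
    (map_continuous χ).comp QuotientGroup.continuous_mk⟩ : G →ₜ* Circle), fun k hk => by
      change χ (QuotientGroup.mk k) = 1
      rw [(QuotientGroup.eq_one_iff k).2 hk, map_one]⟩
  left_inv γ := rfl
  right_inv χ := by
    apply PontryaginDual.ext
    intro q
    obtain ⟨x, rfl⟩ := QuotientGroup.mk_surjective q
    rfl

/-- Parseval's identity for functions on `G` whose support meets each coset of `K` at most once. -/
theorem hasSum_norm_sq_integral_annihilator {w : G → ℂ} (hw : Continuous w)
    (hs : HasCompactSupport w) (hinj : ∀ x, ∀ k ∈ K, w x ≠ 0 → w (x * k) ≠ 0 → k = 1) :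
    HasSum (fun γ : annihilator K => ‖∫ x, ((γ : PontryaginDual G) x : ℂ) * w x ∂μ‖ ^ 2)
      (quotientVolume μ K * ∫ x, ‖w x‖ ^ 2 ∂μ) := by
  borelize (G ⧸ K)
  let ν : Measure (G ⧸ K) := Measure.haarMeasure ⊤
  have : IsProbabilityMeasure ν := ⟨Measure.haarMeasure_self⟩
  have h1 := (annihilatorEquiv K).hasSum_iff.2 (hasSum_norm_sq_integral_character ν
    ⟨periodization K w, continuous_periodization K hw hs⟩)
  have h2 (γ : annihilator K) : ∫ x, ((γ : PontryaginDual G) x : ℂ) * w x ∂μ =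
      quotientVolume μ K * ∫ q, (annihilatorEquiv K γ q : ℂ) * periodization K w q ∂ν := by
    have hγ : Continuous fun x => ((γ : PontryaginDual G) x : ℂ) :=
      continuous_subtype_val.comp (map_continuous _)
    refine (integral_eq_quotientVolume_mul μ K (hγ.mul hw) hs.mul_left).trans ?_
    congr 2 with q
    rw [periodization, periodization, ← tsum_mul_left]
    refine tsum_congr fun k => ?_
    have h3 : annihilatorEquiv K γ q = (γ : PontryaginDual G) (q.out * k) := by
      rw [map_mul, γ.2 k k.2, mul_one]
      conv_lhs => rw [← QuotientGroup.out_eq' q]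
      rfl
    rw [h3]
    rfl
  -- Each coset carries at most one nonzero value of `w`, so squaring commutes with periodization.
  have h4 : ∫ x, ‖w x‖ ^ 2 ∂μ = quotientVolume μ K * ∫ q, ‖periodization K w q‖ ^ 2 ∂ν := by
    rw [integral_eq_quotientVolume_mul_real μ K (f := fun x => ‖w x‖ ^ 2) (by fun_prop)
      (hs.comp_left (g := fun z => ‖z‖ ^ 2) (by simp))]
    congr 2 with q
    rw [periodization, periodization]
    by_cases h : ∃ k : K, w (q.out * k) ≠ 0
    · obtain ⟨k, hk⟩ := h
      have h0 : ∀ k' ≠ k, w (q.out * (k' : K)) = 0 := by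
        intro k' hk'
        by_contra hne
        refine hk' (inv_mul_eq_one.1 (Subtype.ext (hinj _ (k⁻¹ * k' : K) (Subtype.mem _) hk ?_))).symm
        simpa [mul_assoc] using hne
      rw [tsum_eq_single k h0, tsum_eq_single k fun k' hk' => by simp [h0 k' hk']]
    · push Not at h
      simp [h]
  -- Squared coefficients scale by the square of the volume, the squared norm by its first power;
  -- one factor survives.
  have h5 := h1.mul_left (quotientVolume μ K ^ 2)
  rw [sq, mul_assoc] at h5
  simp_rw [h4, h2, norm_mul, mul_pow, Complex.norm_real, Real.norm_eq_abs, sq_abs, sq]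
  simp_rw [Function.comp_def, sq] at h5
  exact h5

end Periodization

/-! ### Bessel families, density arguments and inner products in `L²`. -/

theorem hasSum_prod_of_nonneg {α β : Type*} {f : α × β → ℝ} (hf : 0 ≤ f) {g : α → ℝ} {a : ℝ}
    (h1 : ∀ x, HasSum (fun y => f (x, y)) (g x)) (h2 : HasSum g a) : HasSum f a := by
  have hs : Summable f := (summable_prod_of_nonneg hf).2
    ⟨fun x => (h1 x).summable, by simpa only [(h1 _).tsum_eq] using h2.summable⟩
  exact (hs.hasSum.prod_fiberwise h1).unique h2 ▸ hs.hasSum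

section Analysis

variable {ι E : Type*} [NormedAddCommGroup E] [InnerProductSpace ℂ E]

/-- The analysis operator `u ↦ (⟨v i, u⟩)_i` of a Bessel family `v`. -/
theorem exists_analysisOperator (v : ι → E) (B : ℝ)
    (hB : ∀ u, Summable (fun i => ‖inner ℂ (v i) u‖ ^ 2) ∧
      ∑' i, ‖inner ℂ (v i) u‖ ^ 2 ≤ B * ‖u‖ ^ 2) :
    ∃ C : E →L[ℂ] lp (fun _ : ι => ℂ) 2, ∀ u, HasSum (fun i => ‖inner ℂ (v i) u‖ ^ 2) (‖C u‖ ^ 2) := by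
  have hmem : ∀ u, Memℓp (fun i => inner ℂ (v i) u) 2 := fun u => by
    refine memℓp_gen ?_
    simpa using (hB u).1
  let C₀ : E →ₗ[ℂ] lp (fun _ : ι => ℂ) 2 :=
    { toFun := fun u => ⟨fun i => inner ℂ (v i) u, hmem u⟩
      map_add' := fun u u' => by ext i; exact inner_add_right _ _ _
      map_smul' := fun c u => by ext i; exact inner_smul_right _ _ _ }
  have hC : ∀ u, ‖C₀ u‖ ^ 2 = ∑' i, ‖inner ℂ (v i) u‖ ^ 2 := fun u => by
    have := lp.norm_rpow_eq_tsum (p := 2) (by simp) (C₀ u)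
    have h2 : ‖C₀ u‖ ^ 2 = ∑' i, ‖C₀ u i‖ ^ 2 := by simpa using this
    exact h2
  refine ⟨C₀.mkContinuous (Real.sqrt B) fun u => ?_, fun u => ?_⟩
  · refine le_of_sq_le_sq ?_ (by positivity)
    -- No sign is assumed for `B`; a nonzero `u` forces `B ≥ 0`.
    rcases eq_or_ne u 0 with rfl | hu
    · simp
    have hB0 : 0 ≤ B := by
      have h1 := (hB u).2
      have h2 : 0 ≤ ∑' i, ‖inner ℂ (v i) u‖ ^ 2 := tsum_nonneg fun i => by positivity
      have h3 : 0 < ‖u‖ ^ 2 := by positivity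
      by_contra h
      nlinarith
    rw [mul_pow, Real.sq_sqrt hB0, hC]
    exact (hB u).2
  · change HasSum _ (‖C₀ u‖ ^ 2)
    rw [hC]
    exact (hB u).1.hasSum

/-- Finite partial sums are continuous, so the Bessel bound extends from `D` to all of `E`. The
analysis operator is then bounded, and `‖C u‖² = c ‖u‖²` is a closed condition. -/
theorem hasSum_norm_sq_inner_of_dense (v : ι → E) (c : ℝ) {D : Set E} (hD : Dense D)
    (h : ∀ u ∈ D, HasSum (fun i => ‖inner ℂ (v i) u‖ ^ 2) (c * ‖u‖ ^ 2)) (u : E) :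
    HasSum (fun i => ‖inner ℂ (v i) u‖ ^ 2) (c * ‖u‖ ^ 2) := by
  have hfin : ∀ s : Finset ι, ∀ u, ∑ i ∈ s, ‖inner ℂ (v i) u‖ ^ 2 ≤ c * ‖u‖ ^ 2 := fun s u => by
    have hcl : IsClosed {u : E | ∑ i ∈ s, ‖inner ℂ (v i) u‖ ^ 2 ≤ c * ‖u‖ ^ 2} :=
      isClosed_le (by fun_prop) (by fun_prop)
    exact hcl.closure_subset_iff.2 (fun u hu => sum_le_hasSum s (fun _ _ => by positivity) (h u hu))
      (hD u)
  have hs : ∀ u, Summable (fun i => ‖inner ℂ (v i) u‖ ^ 2) := fun u =>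
    summable_of_sum_le (fun i => by positivity) (fun s => hfin s u)
  obtain ⟨C, hC⟩ := exists_analysisOperator v c fun u =>
    ⟨hs u, (hs u).tsum_le_of_sum_le (fun s => hfin s u)⟩
  have hcl : IsClosed {u : E | ‖C u‖ ^ 2 = c * ‖u‖ ^ 2} :=
    isClosed_eq (by fun_prop) (by fun_prop)
  have h1 : ‖C u‖ ^ 2 = c * ‖u‖ ^ 2 :=
    hcl.closure_subset_iff.2 (fun u hu => (hC u).unique (h u hu)) (hD u)
  exact h1 ▸ hC u

end Analysis

section L2

variable {X : Type*} [MeasurableSpace X] {μ : Measure X}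

theorem inner_toLp {f g : X → ℂ} (hf : MemLp f 2 μ) (hg : MemLp g 2 μ) :
    inner ℂ (hf.toLp f) (hg.toLp g) = ∫ x, g x * (starRingEnd ℂ) (f x) ∂μ := by
  rw [L2.inner_def]
  refine integral_congr_ae ?_
  filter_upwards [hf.coeFn_toLp, hg.coeFn_toLp] with x h1 h2
  rw [h1, h2]
  rfl

theorem norm_sq_toLp {f : X → ℂ} (hf : MemLp f 2 μ) :
    ‖hf.toLp f‖ ^ 2 = ∫ x, ‖f x‖ ^ 2 ∂μ := by
  have h1 := (inner_self_eq_norm_sq_to_K (𝕜 := ℂ) (hf.toLp f)).symm.trans (inner_toLp hf hf)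
  simp_rw [Complex.mul_conj, Complex.normSq_eq_norm_sq, integral_complex_ofReal] at h1
  refine Complex.ofReal_injective ?_
  rw [Complex.ofReal_pow]
  exact h1

end L2

/-! ### Test functions and the double sum for continuous windows. -/

section Group

variable {G : Type*} [CommGroup G] [TopologicalSpace G] [IsTopologicalGroup G]
  [T2Space G] [LocallyCompactSpace G]

/-- Choose `V` with `V ∩ K = {1}` and `U` with `U⁻¹ U ⊆ V`. -/
theorem exists_isOpen_separating (K : Subgroup G) [DiscreteTopology K] :
    ∃ U : Set G, IsOpen U ∧ 1 ∈ U ∧ ∀ x, ∀ k ∈ K, x ∈ U → x * k ∈ U → k = 1 := by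
  obtain ⟨V, hV, hV1⟩ := isOpen_induced_iff.1 (isOpen_discrete ({1} : Set K))
  have h1 : V ∈ nhds (1 : G) := hV.mem_nhds (by
    have : (1 : K) ∈ Subtype.val ⁻¹' V := hV1 ▸ rfl
    exact this)
  have h2 : Filter.Tendsto (fun p : G × G => p.1⁻¹ * p.2) (nhds 1 ×ˢ nhds 1) (nhds 1) := by
    rw [← nhds_prod_eq]
    have : Continuous fun p : G × G => p.1⁻¹ * p.2 := by fun_prop
    simpa using this.tendsto (1, 1)
  obtain ⟨U, hU, hUV⟩ := (Filter.mem_prod_same_iff.1 (h2 h1))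
  obtain ⟨W, hWU, hW, hW1⟩ := mem_nhds_iff.1 hU
  refine ⟨W, hW, hW1, fun x k hk hx hxk => ?_⟩
  have h3 : x⁻¹ * (x * k) ∈ V := @hUV (x, x * k) ⟨hWU hx, hWU hxk⟩
  rw [inv_mul_cancel_left] at h3
  have h4 : (⟨k, hk⟩ : K) ∈ ({1} : Set K) := hV1 ▸ h3
  exact congrArg Subtype.val h4

variable [MeasurableSpace G] [BorelSpace G]

/-- A quadratic partition of unity modulo `K₁` by continuous functions with compact supports that
meet each coset of `K₂` at most once. -/
theorem exists_quadratic_partition (K₁ K₂ : Subgroup G) [DiscreteTopology K₁]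
    [CompactSpace (G ⧸ K₁)] [DiscreteTopology K₂] :
    ∃ (t : Finset G) (f : G → G → ℝ), (∀ i, Continuous (f i)) ∧ (∀ i, HasCompactSupport (f i)) ∧
      (∀ i, ∀ x, ∀ k ∈ K₂, f i x ≠ 0 → f i (x * k) ≠ 0 → k = 1) ∧
      ∀ x, ∑ i ∈ t, ∑' k : K₁, f i (x * k) ^ 2 = 1 := by
  obtain ⟨U, hU, hU1, hUK⟩ := exists_isOpen_separating K₂
  have hbump : ∀ y : G, ∃ φ : C(G, ℝ), HasCompactSupport φ ∧ φ y = 1 ∧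
      ∀ x, φ x ≠ 0 → y⁻¹ * x ∈ U := fun y => by
    obtain ⟨φ, h1, h2, h3, h4⟩ := exists_continuousMap_one_of_isCompact_subset_isOpen
      (isCompact_singleton (x := y)) (hU.preimage (continuous_const_mul y⁻¹)) (by simpa using hU1)
    exact ⟨φ, h2, h1 rfl, fun x hx => h3 (subset_tsupport _ hx)⟩
  choose φ hφc hφ1 hφU using hbump
  have hopen : ∀ y, IsOpen ((QuotientGroup.mk : G → G ⧸ K₁) '' {x | φ y x ≠ 0}) := fun y =>
    QuotientGroup.isOpenMap_coe _ (isOpen_ne_fun (φ y).continuous continuous_const)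
  obtain ⟨t, ht⟩ := isCompact_univ.elim_finite_subcover _ hopen fun q _ => by
    obtain ⟨y, rfl⟩ := QuotientGroup.mk_surjective q
    exact Set.mem_iUnion.2 ⟨y, y, by simp [hφ1], rfl⟩
  let Ψ : G → ℝ := fun x => ∑ y ∈ t, φ y x ^ 2
  have hsq : ∀ y, HasCompactSupport fun x => φ y x ^ 2 := fun y =>
    (hφc y).comp_left (g := fun z => z ^ 2) (by simp)
  have hΨc : Continuous Ψ := by fun_prop
  have hΨs : HasCompactSupport Ψ := by
    refine HasCompactSupport.intro (t.isCompact_biUnion fun y _ => hsq y) fun x hx => ?_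
    refine Finset.sum_eq_zero fun y hy => ?_
    by_contra h
    exact hx (Set.mem_biUnion hy (subset_tsupport _ h))
  -- `P` is positive and `K₁`-invariant, so dividing each bump by its square root normalizes the sum
  -- without enlarging supports.
  let P : G → ℝ := fun x => periodization K₁ Ψ x
  have hPc : Continuous P := (continuous_periodization K₁ hΨc hΨs).comp QuotientGroup.continuous_mk
  have hPk : ∀ x, ∀ k : K₁, P (x * k) = P x := fun x k => by
    simp only [P]
    congr 1
    simp
  have hsum : ∀ y x, Summable fun k : K₁ => φ y (x * k) ^ 2 := fun y x =>
    summable_of_hasFiniteSupport (finite_support_mul K₁ (hsq y) x)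
  have hP : ∀ x, P x = ∑ y ∈ t, ∑' k : K₁, φ y (x * k) ^ 2 := fun x => by
    simp only [P, periodization_mk, Ψ]
    exact Summable.tsum_finsetSum fun y _ => hsum y x
  have hpos : ∀ x, 0 < P x := fun x => by
    obtain ⟨y, hy, z, hz, hzx⟩ : ∃ y ∈ t, ∃ z, φ y z ≠ 0 ∧ (z : G ⧸ K₁) = x := by
      simpa using ht (Set.mem_univ (x : G ⧸ K₁))
    rw [hP]
    refine Finset.sum_pos' (fun y _ => tsum_nonneg fun k => by positivity) ⟨y, hy, ?_⟩
    have hk : x⁻¹ * z ∈ K₁ := QuotientGroup.eq.1 hzx.symm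
    refine (hsum y x).tsum_pos (fun k => by positivity) ⟨x⁻¹ * z, hk⟩ ?_
    simp only [mul_inv_cancel_left]
    positivity
  refine ⟨t, fun y x => φ y x / Real.sqrt (P x), fun y => ?_, fun y => ?_, fun y x k hk h1 h2 => ?_,
    fun x => ?_⟩
  · exact (φ y).continuous.div (by fun_prop) fun x => (Real.sqrt_pos.2 (hpos x)).ne'
  · simp only [div_eq_mul_inv]
    exact (hφc y).mul_right
  · refine hUK (y⁻¹ * x) k hk (hφU y x (div_ne_zero_iff.1 h1).1) ?_
    rw [mul_assoc]
    exact hφU y _ (div_ne_zero_iff.1 h2).1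
  · simp only [div_pow, Real.sq_sqrt (hpos _).le, hPk, tsum_div_const]
    rw [← Finset.sum_div, ← hP, div_self (hpos x).ne']

variable (μ : Measure G) [μ.IsHaarMeasure] [μ.Regular]

theorem modTrans_toLp (x : G) (γ : PontryaginDual G) {u : G → ℂ} (hu : MemLp u 2 μ) :
    ∃ h : MemLp (fun t => (γ t : ℂ) * u (t * x⁻¹)) 2 μ,
      modTrans μ x γ (hu.toLp u) = h.toLp (fun t => (γ t : ℂ) * u (t * x⁻¹)) := by
  have h1 := memLp_modTrans μ x γ (hu.toLp u)
  have h2 : (fun t => (γ t : ℂ) * (hu.toLp u) (t * x⁻¹)) =ᵐ[μ]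
      fun t => (γ t : ℂ) * u (t * x⁻¹) := by
    filter_upwards [(measurePreserving_mul_right μ x⁻¹).quasiMeasurePreserving.ae
      hu.coeFn_toLp] with t ht
    rw [ht]
  exact ⟨(memLp_congr_ae h2).1 h1, MemLp.toLp_congr _ _ h2⟩

variable (K₁ K₂ : Subgroup G) [DiscreteTopology K₁] [DiscreteTopology K₂]

open scoped Pointwise in
theorem hasSum_integral_translate {f : G → ℝ} {u : G → ℂ} (hf : Continuous f)
    (hfs : HasCompactSupport f) (hu : Continuous u) (hus : HasCompactSupport u) :
    HasSum (fun k : K₁ => ∫ x, ‖(f x : ℂ) * u (x * (k : G)⁻¹)‖ ^ 2 ∂μ)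
      (∫ x, (∑' k : K₁, f (x * k) ^ 2) * ‖u x‖ ^ 2 ∂μ) := by
  -- Only these finitely many `k` make the supports overlap, so sum and integral may be exchanged.
  have hfin : {k : K₁ | (k : G) ∈ (tsupport u)⁻¹ * tsupport f}.Finite :=
    (((Subgroup.isClosed_of_discrete (H := K₁)).isClosedEmbedding_subtypeVal.isCompact_preimage
      (hus.isCompact.inv.mul hfs.isCompact))).finite_of_discrete
  have h0 : ∀ x, ∀ k ∉ hfin.toFinset, f (x * (k : K₁)) ^ 2 * ‖u x‖ ^ 2 = 0 := by
    intro x k hk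
    by_contra h
    rw [Set.Finite.mem_toFinset, Set.mem_ofPred_eq] at hk
    refine hk (Set.mem_mul.2 ⟨x⁻¹, ?_, x * k, ?_, inv_mul_cancel_left _ _⟩)
    · exact Set.inv_mem_inv.2 (subset_tsupport _ fun h' => h (by simp [h']))
    · exact subset_tsupport _ fun h' => h (by simp [h'])
  have h1 : ∀ k : K₁, ∫ x, ‖(f x : ℂ) * u (x * (k : G)⁻¹)‖ ^ 2 ∂μ =
      ∫ x, f (x * k) ^ 2 * ‖u x‖ ^ 2 ∂μ := fun k => by
    rw [← integral_mul_right_eq_self _ (k : G)]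
    simp [mul_pow]
  have h2 : ∀ x, (∑' k : K₁, f (x * k) ^ 2) * ‖u x‖ ^ 2 =
      ∑ k ∈ hfin.toFinset, f (x * k) ^ 2 * ‖u x‖ ^ 2 := fun x => by
    rw [← tsum_mul_right, tsum_eq_sum (h0 x)]
  simp_rw [h1, h2]
  rw [integral_finsetSum]
  · refine hasSum_sum_of_ne_finset_zero fun k hk => ?_
    simp [h0 _ k hk]
  · intro k _
    refine Continuous.integrable_of_hasCompactSupport (by fun_prop) ?_
    exact (hus.comp_left (g := fun z => ‖z‖ ^ 2) (by simp)).mul_left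

/-- For fixed `k`, the product `f · T_k u` inherits the coset condition from `f`, so Parseval over
`Ann(K₂)` applies; then sum over `k`. -/
theorem hasSum_inner_modTrans_toLp [CompactSpace (G ⧸ K₂)] {f : G → ℝ} {u : G → ℂ}
    (hf : Continuous f)
    (hfs : HasCompactSupport f) (hfK : ∀ x, ∀ k ∈ K₂, f x ≠ 0 → f (x * k) ≠ 0 → k = 1)
    (hF : MemLp (fun x => (f x : ℂ)) 2 μ) (hu : Continuous u) (hus : HasCompactSupport u)
    (hU : MemLp u 2 μ) :
    HasSum (fun p : K₁ × annihilator K₂ =>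
      ‖inner ℂ (hF.toLp _) (modTrans μ (p.1 : G) (p.2 : PontryaginDual G) (hU.toLp u))‖ ^ 2)
      (quotientVolume μ K₂ * ∫ x, (∑' k : K₁, f (x * k) ^ 2) * ‖u x‖ ^ 2 ∂μ) := by
  refine hasSum_prod_of_nonneg (fun _ => by positivity) (fun k => ?_)
    ((hasSum_integral_translate μ K₁ hf hfs hu hus).mul_left (quotientVolume μ K₂))
  have hfc : HasCompactSupport fun x => (f x : ℂ) :=
    hfs.comp_left (g := fun z : ℝ => (z : ℂ)) (by simp)
  have h1 := hasSum_norm_sq_integral_annihilator μ K₂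
    (w := fun x => (f x : ℂ) * u (x * (k : G)⁻¹)) (by fun_prop) hfc.mul_right
    (fun x l hl h h' => hfK x l hl (by exact_mod_cast (mul_ne_zero_iff.1 h).1)
      (by exact_mod_cast (mul_ne_zero_iff.1 h').1))
  have h2 : ∀ γ : annihilator K₂,
      inner ℂ (hF.toLp _) (modTrans μ (k : G) (γ : PontryaginDual G) (hU.toLp u)) =
        ∫ x, ((γ : PontryaginDual G) x : ℂ) * ((f x : ℂ) * u (x * (k : G)⁻¹)) ∂μ := fun γ => by
    obtain ⟨h, hh⟩ := modTrans_toLp μ (k : G) (γ : PontryaginDual G) hU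
    rw [hh, inner_toLp]
    refine integral_congr_ae (.of_forall fun x => ?_)
    simp only [Complex.conj_ofReal]
    ring
  simp_rw [h2]
  exact h1

/-- Regularity traps a set of finite measure between a compact `C` and an open `V` with `V \ C`
small; a Urysohn function differs from the indicator only there. -/
theorem exists_hasCompactSupport_eLpNorm_sub_le {u : G → ℂ} (hu : MemLp u 2 μ) {ε : ℝ≥0∞}
    (hε : ε ≠ 0) :
    ∃ v : G → ℂ, eLpNorm (u - v) 2 μ ≤ ε ∧ Continuous v ∧ HasCompactSupport v := by
  refine hu.induction_dense (by simp) _ ?_ ?_ ?_ hε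
  · intro c t ht htμ ε hε
    obtain ⟨η, ηpos, hη⟩ := exists_eLpNorm_indicator_le (p := 2) (μ := μ) (by simp) c hε
    have hη2 : ((η / 2 : ℝ≥0) : ℝ≥0∞) ≠ 0 := by
      have : (η / 2 : ℝ≥0) ≠ 0 := by positivity
      exact_mod_cast this
    obtain ⟨V, htV, hV, -, hVt⟩ := ht.exists_isOpen_sdiff_lt htμ.ne hη2
    obtain ⟨C, hCt, hC, -, htC⟩ := ht.exists_isCompact_isClosed_sdiff_lt htμ.ne hη2
    obtain ⟨φ, h1, h2, h3, h4⟩ :=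
      exists_continuousMap_one_of_isCompact_subset_isOpen hC hV (hCt.trans htV)
    refine ⟨fun x => (φ x : ℂ) * c, ?_, by fun_prop,
      (HasCompactSupport.comp_left (f := φ) h2 (g := fun z : ℝ => (z : ℂ)) (by simp)).mul_right⟩
    have hle : μ (V \ C) ≤ η := by
      have h5 : V \ C ⊆ (V \ t) ∪ (t \ C) := fun x hx => by
        by_cases hxt : x ∈ t
        · exact Or.inr ⟨hxt, hx.2⟩
        · exact Or.inl ⟨hx.1, hxt⟩
      refine (measure_mono h5).trans ((measure_union_le _ _).trans ?_)
      refine (add_le_add hVt.le htC.le).trans ?_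
      rw [← ENNReal.coe_add, add_halves]
    refine (eLpNorm_mono fun x => ?_).trans (hη _ hle)
    have h6 : ‖(φ x : ℂ) * c‖ ≤ ‖c‖ := by
      rw [norm_mul, Complex.norm_real, Real.norm_eq_abs, abs_of_nonneg (h4 x).1]
      exact mul_le_of_le_one_left (norm_nonneg _) (h4 x).2
    have h7 : ‖(φ x : ℂ) * c - c‖ ≤ ‖c‖ := by
      have : (φ x : ℂ) * c - c = -(((1 - φ x : ℝ) : ℂ) * c) := by push_cast; ring
      rw [this, norm_neg, norm_mul, Complex.norm_real, Real.norm_eq_abs,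
        abs_of_nonneg (sub_nonneg.2 (h4 x).2)]
      exact mul_le_of_le_one_left (norm_nonneg _) (by linarith [(h4 x).1])
    rw [Pi.sub_apply]
    by_cases hxC : x ∈ C
    · simp [hCt hxC, h1 hxC, hxC]
    · by_cases hxV : x ∈ V
      · rw [Set.indicator_of_mem (show x ∈ V \ C from ⟨hxV, hxC⟩)]
        by_cases hxt : x ∈ t
        · simpa [hxt] using h7
        · simpa [hxt] using h6
      · have h8 : φ x = 0 := by
          by_contra h
          exact hxV (h3 (subset_tsupport _ h))
        simp [show x ∉ t from fun h => hxV (htV h), h8]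
  · rintro f g ⟨hf, hfs⟩ ⟨hg, hgs⟩
    exact ⟨hf.add hg, hfs.add hgs⟩
  · rintro f ⟨hf, hfs⟩
    exact (hf.memLp_of_hasCompactSupport hfs (p := 2)).aestronglyMeasurable

theorem dense_toLp_hasCompactSupport :
    Dense {U : Lp ℂ 2 μ | ∃ u : G → ℂ, Continuous u ∧ HasCompactSupport u ∧
      ∃ h : MemLp u 2 μ, U = h.toLp u} := by
  intro U
  rw [EMetric.mem_closure_iff]
  intro ε hε
  obtain ⟨δ, hδ, hδε⟩ := exists_between hε
  obtain ⟨u, hle, huc, hus⟩ := exists_hasCompactSupport_eLpNorm_sub_le μ (Lp.memLp U) hδ.ne'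
  have hu : MemLp u 2 μ := huc.memLp_of_hasCompactSupport hus
  refine ⟨hu.toLp u, ⟨u, huc, hus, hu, rfl⟩, ?_⟩
  rw [← Lp.toLp_coeFn U (Lp.memLp U), Lp.edist_toLp_toLp]
  exact hle.trans_lt hδε

end Group

/-! ### Abstract frames, Parseval families and Riesz bases. -/

section Frame

variable {ι E : Type*} [NormedAddCommGroup E] [InnerProductSpace ℂ E] [CompleteSpace E]

/-- The square root `Q` of the frame operator of a frame `f`: it is positive, invertible, satisfies
`∑ |⟨u, f i⟩|² = ‖Q u‖²`, and commutes with every unitary that preserves these sums. -/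
theorem IsFrame.exists_sqrt_frameOperator {f : ι → E} (hf : IsFrame f) :
    ∃ Q : E →L[ℂ] E, IsSelfAdjoint Q ∧ IsUnit Q ∧
      (∀ u, HasSum (fun i => ‖inner ℂ u (f i)‖ ^ 2) (‖Q u‖ ^ 2)) ∧
      ∀ T : unitary (E →L[ℂ] E), (∀ u, ‖Q ((T : E →L[ℂ] E) u)‖ = ‖Q u‖) → Commute (T : E →L[ℂ] E) Q := by
  obtain ⟨A, B, hA, -, h⟩ := hf
  obtain ⟨C, hC⟩ := exists_analysisOperator f B fun u => by
    simp_rw [norm_inner_symm (f _) u]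
    exact ⟨(h u).1, (h u).2.2⟩
  simp_rw [norm_inner_symm (f _)] at hC
  let S : E →L[ℂ] E := C.adjoint ∘L C
  have hS : 0 ≤ S := (ContinuousLinearMap.nonneg_iff_isPositive S).2
    (ContinuousLinearMap.isPositive_adjoint_comp_self C)
  have hSu : ∀ u, inner ℂ (S u) u = ((‖C u‖ ^ 2 : ℝ) : ℂ) := fun u => by
    change inner ℂ (C.adjoint (C u)) u = _
    rw [ContinuousLinearMap.adjoint_inner_left, inner_self_eq_norm_sq_to_K, Complex.ofReal_pow]
    rfl
  -- The lower frame bound makes `S` coercive.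
  have hunit : IsUnit S := by
    refine ContinuousLinearMap.isUnit_of_forall_le_norm_inner_map S (c := ⟨A, hA.le⟩) hA
      fun u => ?_
    rw [hSu, Complex.norm_real, Real.norm_of_nonneg (by positivity), mul_comm]
    rw [← (hC u).tsum_eq]
    exact (h u).2.1
  let Q := CFC.sqrt S
  have hQQ : Q * Q = S := CFC.sqrt_mul_sqrt_self S
  have hQs : IsSelfAdjoint Q := (CFC.sqrt_nonneg S).isSelfAdjoint
  have hQC : ∀ u, ‖Q u‖ = ‖C u‖ := fun u => by
    have h1 : inner ℂ (S u) u = ((‖Q u‖ ^ 2 : ℝ) : ℂ) := by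
      rw [← hQQ]
      change inner ℂ (Q (Q u)) u = _
      rw [← ContinuousLinearMap.adjoint_inner_right, hQs.adjoint_eq, inner_self_eq_norm_sq_to_K,
        Complex.ofReal_pow]
      rfl
    have h2 : ‖Q u‖ ^ 2 = ‖C u‖ ^ 2 := by exact_mod_cast h1.symm.trans (hSu u)
    exact (sq_eq_sq₀ (norm_nonneg _) (norm_nonneg _)).1 h2
  refine ⟨Q, hQs, isUnit_mul_self_iff.1 (hQQ ▸ hunit), fun u => hQC u ▸ hC u, fun T hT => ?_⟩
  -- `T` preserves the quadratic form of `S`, hence `S` itself by polarization. Being unitary, `T`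
  -- commutes with `S` and so with its square root.
  have h1 : star (T : E →L[ℂ] E) * S * T = S := by
    have h2 : ((star (T : E →L[ℂ] E) * S * T : E →L[ℂ] E) : E →ₗ[ℂ] E) = S := by
      rw [← ext_inner_map]
      intro u
      change inner ℂ (ContinuousLinearMap.adjoint (T : E →L[ℂ] E) (S ((T : E →L[ℂ] E) u))) u =
        inner ℂ (S u) u
      rw [ContinuousLinearMap.adjoint_inner_left, hSu, hSu, ← hQC, ← hQC, hT]
    exact ContinuousLinearMap.coe_injective h2
  have h2 : Commute S (T : E →L[ℂ] E) := by
    change S * (T : E →L[ℂ] E) = T * S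
    conv_rhs => rw [← h1]
    rw [← mul_assoc, ← mul_assoc, Unitary.mul_star_self_of_mem T.2, one_mul]
  exact (h2.cfcₙ_nnreal NNReal.sqrt).symm

/-- A Parseval family of unit vectors is an orthonormal basis. -/
theorem exists_hilbertBasis_of_parseval {e : ι → E}
    (he : ∀ u, HasSum (fun i => ‖inner ℂ u (e i)‖ ^ 2) (‖u‖ ^ 2)) (h1 : ∀ i, ‖e i‖ = 1) :
    ∃ b : HilbertBasis ι ℂ E, ∀ i, b i = e i := by
  classical
  have ho : Orthonormal ℂ e := by
    refine ⟨h1, fun i j hij => ?_⟩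
    -- At `u = e i` the term `i` alone exhausts `‖e i‖² = 1`, leaving nothing for `j`.
    have h2 := sum_le_hasSum {i, j} (fun _ _ => by positivity) (he (e i))
    rw [Finset.sum_pair hij, inner_self_eq_norm_sq_to_K, h1] at h2
    have h3 : ‖inner ℂ (e i) (e j)‖ ^ 2 ≤ 0 := by
      simpa using h2
    simpa using h3
  have hbot : (Submodule.span ℂ (Set.range e))ᗮ = ⊥ := by
    rw [Submodule.eq_bot_iff]
    intro u hu
    have h2 : ∀ i, ‖inner ℂ u (e i)‖ ^ 2 = 0 := fun i => by
      rw [(Submodule.mem_orthogonal' _ u).1 hu _ (Submodule.subset_span ⟨i, rfl⟩)]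
      simp
    have h3 := he u
    simp_rw [h2] at h3
    simpa using h3.unique hasSum_zero
  exact ⟨HilbertBasis.mkOfOrthogonalEqBot ho hbot,
    congrFun (HilbertBasis.coe_mkOfOrthogonalEqBot ho hbot)⟩

/-- A Parseval Riesz basis consists of unit vectors. -/
theorem norm_eq_one_of_parseval (b : HilbertBasis ι ℂ E) (V : E →L[ℂ] E)
    (hV : Function.Injective V)
    (he : ∀ u, HasSum (fun i => ‖inner ℂ u (V (b i))‖ ^ 2) (‖u‖ ^ 2)) (i : ι) :
    ‖V (b i)‖ = 1 := by
  have h1 : ∀ u, ‖V.adjoint u‖ = ‖u‖ := fun u => by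
    have h2 := b.hasSum_norm_sq_inner (V.adjoint u)
    simp_rw [ContinuousLinearMap.adjoint_inner_left] at h2
    exact (sq_eq_sq₀ (norm_nonneg _) (norm_nonneg _)).1 (h2.unique (he u))
  -- `V*` is isometric, so `V V* = 1`; injectivity of `V` upgrades this to `V* V = 1`.
  have h2 := (ContinuousLinearMap.norm_map_iff_adjoint_comp_self V.adjoint).1 h1
  rw [ContinuousLinearMap.adjoint_adjoint] at h2
  have h3 : V.adjoint (V (b i)) = b i :=
    hV (congrArg (fun S : E →L[ℂ] E => S (V (b i))) h2)
  rw [← h1, h3]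
  exact b.orthonormal.1 i

end Frame

/-! ### Time-frequency shifts and the volume identity. -/

section Group

variable {G : Type*} [CommGroup G] [TopologicalSpace G] [IsTopologicalGroup G]
  [T2Space G] [LocallyCompactSpace G] [MeasurableSpace G] [BorelSpace G]
  (μ : Measure G) [μ.IsHaarMeasure]

theorem coeFn_modTrans (x : G) (γ : PontryaginDual G) (g : Lp ℂ 2 μ) :
    modTrans μ x γ g =ᵐ[μ] fun t => (γ t : ℂ) * g (t * x⁻¹) :=
  (memLp_modTrans μ x γ g).coeFn_toLp

theorem ae_mul_right {p : G → Prop} (h : ∀ᵐ t ∂μ, p t) (x : G) : ∀ᵐ t ∂μ, p (t * x) :=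
  (measurePreserving_mul_right μ x).quasiMeasurePreserving.ae h

/-- Shifts compose only up to a unimodular phase, which is harmless since frame sums see only
moduli. -/
theorem modTrans_modTrans (x y : G) (γ δ : PontryaginDual G) (g : Lp ℂ 2 μ) :
    modTrans μ x γ (modTrans μ y δ g) = (δ x⁻¹ : ℂ) • modTrans μ (x * y) (γ * δ) g := by
  refine Lp.ext ?_
  filter_upwards [coeFn_modTrans μ x γ (modTrans μ y δ g), coeFn_modTrans μ (x * y) (γ * δ) g,
    ae_mul_right μ (coeFn_modTrans μ y δ g) x⁻¹,
    Lp.coeFn_smul (δ x⁻¹ : ℂ) (modTrans μ (x * y) (γ * δ) g)] with t h1 h2 h3 h4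
  rw [h1, h3, h4, Pi.smul_apply, h2, map_mul, mul_inv_rev, mul_assoc t, mul_comm x⁻¹ y⁻¹]
  change _ = (δ x⁻¹ : ℂ) • (((γ t * δ t : Circle) : ℂ) * _)
  simp only [Circle.coe_mul, smul_eq_mul]
  ring

theorem modTrans_one (g : Lp ℂ 2 μ) : modTrans μ 1 1 g = g := by
  refine Lp.ext ?_
  filter_upwards [coeFn_modTrans μ 1 1 g] with t h1
  rw [h1]
  simp

theorem modTrans_add (x : G) (γ : PontryaginDual G) (g h : Lp ℂ 2 μ) :
    modTrans μ x γ (g + h) = modTrans μ x γ g + modTrans μ x γ h := by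
  refine Lp.ext ?_
  filter_upwards [coeFn_modTrans μ x γ (g + h), coeFn_modTrans μ x γ g, coeFn_modTrans μ x γ h,
    ae_mul_right μ (Lp.coeFn_add g h) x⁻¹, Lp.coeFn_add (modTrans μ x γ g) (modTrans μ x γ h)]
    with t h1 h2 h3 h4 h5
  rw [h1, h4, h5, Pi.add_apply, Pi.add_apply, h2, h3, mul_add]

theorem modTrans_smul (x : G) (γ : PontryaginDual G) (c : ℂ) (g : Lp ℂ 2 μ) :
    modTrans μ x γ (c • g) = c • modTrans μ x γ g := by
  refine Lp.ext ?_
  filter_upwards [coeFn_modTrans μ x γ (c • g), coeFn_modTrans μ x γ g,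
    ae_mul_right μ (Lp.coeFn_smul c g) x⁻¹, Lp.coeFn_smul c (modTrans μ x γ g)]
    with t h1 h2 h3 h4
  rw [h1, h3, h4, Pi.smul_apply, Pi.smul_apply, h2, smul_eq_mul, smul_eq_mul]
  ring

theorem norm_modTrans (x : G) (γ : PontryaginDual G) (g : Lp ℂ 2 μ) :
    ‖modTrans μ x γ g‖ = ‖g‖ := by
  rw [← sq_eq_sq₀ (norm_nonneg _) (norm_nonneg _), modTrans, norm_sq_toLp]
  conv_rhs => rw [← Lp.toLp_coeFn g (Lp.memLp g), norm_sq_toLp,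
    ← integral_mul_right_eq_self _ x⁻¹]
  simp_rw [norm_mul, Circle.norm_coe, one_mul]

/-- The time-frequency shift as a unitary operator on `L²(G)`. -/
noncomputable def modTransIsometryEquiv (x : G) (γ : PontryaginDual G) :
    Lp ℂ 2 μ ≃ₗᵢ[ℂ] Lp ℂ 2 μ :=
  LinearIsometryEquiv.ofSurjective
    { toFun := modTrans μ x γ
      map_add' := modTrans_add μ x γ
      map_smul' := modTrans_smul μ x γ
      norm_map' := norm_modTrans μ x γ } fun g => by
    refine ⟨modTrans μ x⁻¹ γ⁻¹ ((γ x⁻¹ : ℂ) • g), ?_⟩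
    change modTrans μ x γ (modTrans μ x⁻¹ γ⁻¹ ((γ x⁻¹ : ℂ) • g)) = g
    rw [modTrans_modTrans, mul_inv_cancel, mul_inv_cancel, modTrans_one, smul_smul,
      ← Circle.coe_mul]
    change (((γ x⁻¹)⁻¹ * γ x⁻¹ : Circle) : ℂ) • g = g
    rw [inv_mul_cancel, Circle.coe_one, one_smul]

variable [μ.Regular] (K₁ K₂ : Subgroup G) [DiscreteTopology K₁] [CompactSpace (G ⧸ K₁)]
  [DiscreteTopology K₂] [CompactSpace (G ⧸ K₂)]

theorem sum_integral_periodization_mul {t : Finset G} {f : G → G → ℝ}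
    (hfc : ∀ i, Continuous (f i)) (hfs : ∀ i, HasCompactSupport (f i))
    (hf1 : ∀ x, ∑ i ∈ t, ∑' k : K₁, f i (x * k) ^ 2 = 1) {u : G → ℂ} (huc : Continuous u)
    (hus : HasCompactSupport u) :
    ∑ i ∈ t, ∫ x, (∑' k : K₁, f i (x * k) ^ 2) * ‖u x‖ ^ 2 ∂μ = ∫ x, ‖u x‖ ^ 2 ∂μ := by
  rw [← integral_finsetSum]
  · simp_rw [← Finset.sum_mul, hf1, one_mul]
  · intro i _
    have h1 : Continuous fun x : G => ∑' k : K₁, f i (x * k) ^ 2 := by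
      refine ((continuous_periodization K₁ (f := fun x => f i x ^ 2) (by fun_prop)
        ((hfs i).comp_left (g := fun z => z ^ 2) (by simp))).comp
        QuotientGroup.continuous_mk).congr fun x => ?_
      exact periodization_mk K₁ _ x
    exact Continuous.integrable_of_hasCompactSupport (by fun_prop)
      (hus.comp_left (g := fun z => ‖z‖ ^ 2) (by simp)).mul_left

theorem sum_integral_sq_eq_quotientVolume {t : Finset G} {f : G → G → ℝ}
    (hfc : ∀ i, Continuous (f i)) (hfs : ∀ i, HasCompactSupport (f i))
    (hf1 : ∀ x, ∑ i ∈ t, ∑' k : K₁, f i (x * k) ^ 2 = 1) :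
    ∑ i ∈ t, ∫ x, f i x ^ 2 ∂μ = quotientVolume μ K₁ := by
  have hsq : ∀ i, HasCompactSupport fun x => f i x ^ 2 := fun i =>
    (hfs i).comp_left (g := fun z => z ^ 2) (by simp)
  have hsum : ∀ i x, Summable fun k : K₁ => f i (x * k) ^ 2 := fun i x =>
    summable_of_hasFiniteSupport (finite_support_mul K₁ (hsq i) x)
  have h3 : HasCompactSupport fun x => ∑ i ∈ t, f i x ^ 2 := by
    refine HasCompactSupport.intro (t.isCompact_biUnion fun i _ => hsq i) fun x hx => ?_
    refine Finset.sum_eq_zero fun i hi => ?_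
    by_contra h
    exact hx (Set.mem_biUnion hi (subset_tsupport _ h))
  rw [← integral_eq_quotientVolume μ K₁ (f := fun x => ∑ i ∈ t, f i x ^ 2) (by fun_prop) h3
    fun x => by rw [Summable.tsum_finsetSum fun i _ => hsum i x, hf1]]
  exact (integral_finsetSum _ fun i _ =>
    Continuous.integrable_of_hasCompactSupport (by fun_prop) (hsq i)).symm

/-- The time-frequency shifts of a quadratic partition modulo `K₁` form a tight frame. -/
theorem hasSum_norm_sq_inner_gaborSystem {t : Finset G} {f : G → G → ℝ}
    (hfc : ∀ i, Continuous (f i)) (hfs : ∀ i, HasCompactSupport (f i))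
    (hfK : ∀ i, ∀ x, ∀ k ∈ K₂, f i x ≠ 0 → f i (x * k) ≠ 0 → k = 1)
    (hf1 : ∀ x, ∑ i ∈ t, ∑' k : K₁, f i (x * k) ^ 2 = 1)
    (hF : ∀ i, MemLp (fun x => (f i x : ℂ)) 2 μ) (h : Lp ℂ 2 μ) :
    HasSum (fun p : t × (K₁ × annihilator K₂) =>
      ‖inner ℂ ((hF p.1).toLp _) (gaborSystem μ K₁ K₂ h p.2)‖ ^ 2)
      (quotientVolume μ K₂ * ‖h‖ ^ 2) := by
  -- The inverse shift is moved onto the test function, making the sum a Bessel sum in `u` so that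
  -- density applies.
  let v : t × (K₁ × annihilator K₂) → Lp ℂ 2 μ := fun p =>
    (modTransIsometryEquiv μ (p.2.1 : G) (p.2.2 : PontryaginDual G)).symm ((hF p.1).toLp _)
  have hv : ∀ p u, inner ℂ ((hF p.1).toLp _) (gaborSystem μ K₁ K₂ u p.2) = inner ℂ (v p) u :=
    fun p u => ((modTransIsometryEquiv μ (p.2.1 : G)
      (p.2.2 : PontryaginDual G)).symm.inner_map_eq_flip _ u).symm
  simp_rw [hv]
  refine hasSum_norm_sq_inner_of_dense v (quotientVolume μ K₂)
    (dense_toLp_hasCompactSupport μ) ?_ h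
  rintro U ⟨u, huc, hus, hu, rfl⟩
  simp_rw [← hv]
  refine hasSum_prod_of_nonneg (fun _ => by positivity) (fun i =>
    hasSum_inner_modTrans_toLp μ K₁ K₂ (hfc i) (hfs i) (hfK i) (hF i) huc hus hu) ?_
  rw [norm_sq_toLp, ← sum_integral_periodization_mul μ K₁ hfc hfs hf1 huc hus, Finset.mul_sum,
    ← Finset.sum_coe_sort]
  exact hasSum_fintype _

/-- The volume of `G ⧸ K₁` is determined by the window of a Parseval Gabor frame. -/
theorem quotientVolume_eq_mul_norm_sq_of_parseval (h : Lp ℂ 2 μ)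
    (hp : ∀ u, HasSum (fun p => ‖inner ℂ u (gaborSystem μ K₁ K₂ h p)‖ ^ 2) (‖u‖ ^ 2)) :
    quotientVolume μ K₁ = quotientVolume μ K₂ * ‖h‖ ^ 2 := by
  obtain ⟨t, f, hfc, hfs, hfK, hf1⟩ := exists_quadratic_partition K₁ K₂
  have hF : ∀ i, MemLp (fun x => (f i x : ℂ)) 2 μ := fun i =>
    Continuous.memLp_of_hasCompactSupport (by fun_prop)
      ((hfs i).comp_left (g := fun z : ℝ => (z : ℂ)) (by simp))
  have h1 := hasSum_norm_sq_inner_gaborSystem μ K₁ K₂ hfc hfs hfK hf1 hF h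
  have h2 : HasSum (fun i : t => ‖(hF i).toLp _‖ ^ 2) (quotientVolume μ K₂ * ‖h‖ ^ 2) :=
    h1.prod_fiberwise fun i => hp ((hF i).toLp fun x => (f i x : ℂ))
  have h3 : ∀ i, ‖(hF i).toLp _‖ ^ 2 = ∫ x, f i x ^ 2 ∂μ := fun i => by
    rw [norm_sq_toLp]
    simp only [Complex.norm_real, Real.norm_eq_abs, sq_abs]
  simp_rw [h3] at h2
  rw [h2.unique (hasSum_fintype _), Finset.sum_coe_sort t fun i => ∫ x, f i x ^ 2 ∂μ]
  exact (sum_integral_sq_eq_quotientVolume μ K₁ hfc hfs hf1).symm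

/-- Time-frequency shifts permute a Gabor system up to phases. -/
theorem norm_inner_gaborSystem_mul (h : Lp ℂ 2 μ) (p q : K₁ × annihilator K₂) (u : Lp ℂ 2 μ) :
    ‖inner ℂ (gaborSystem μ K₁ K₂ u p) (gaborSystem μ K₁ K₂ h (p * q))‖ =
      ‖inner ℂ u (gaborSystem μ K₁ K₂ h q)‖ := by
  let e := modTransIsometryEquiv μ (p.1 : G) (p.2 : PontryaginDual G)
  have h1 : e (gaborSystem μ K₁ K₂ h q) = ((q.2 : PontryaginDual G) (p.1 : G)⁻¹ : ℂ) •
    gaborSystem μ K₁ K₂ h (p * q) := modTrans_modTrans μ _ _ _ _ h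
  have h2 : e u = gaborSystem μ K₁ K₂ u p := rfl
  rw [← e.inner_map_map u, h1, h2, inner_smul_right, norm_mul, Circle.norm_coe, one_mul]

/-- The canonical Parseval frame of a Gabor frame is a Gabor system. -/
theorem exists_parseval_window (g : Lp ℂ 2 μ) (hg : IsFrame (gaborSystem μ K₁ K₂ g)) :
    ∃ (h : Lp ℂ 2 μ) (Q R : Lp ℂ 2 μ →L[ℂ] Lp ℂ 2 μ), Q * R = 1 ∧ R * Q = 1 ∧
      (∀ p, R (gaborSystem μ K₁ K₂ g p) = gaborSystem μ K₁ K₂ h p) ∧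
      ∀ u, HasSum (fun p => ‖inner ℂ u (gaborSystem μ K₁ K₂ h p)‖ ^ 2) (‖u‖ ^ 2) := by
  obtain ⟨Q, hQs, hQu, hQ, hcomm⟩ := hg.exists_sqrt_frameOperator
  obtain ⟨⟨Q, R, hQR, hRQ⟩, rfl⟩ := hQu
  -- Multiplication by `p` permutes the index group, so the shift preserves the frame sums and
  -- commutes with `Q`.
  have hQT : ∀ p u, Q (gaborSystem μ K₁ K₂ u p) = gaborSystem μ K₁ K₂ (Q u) p := fun p u => by
    let T := Unitary.linearIsometryEquiv.symm
      (modTransIsometryEquiv μ (p.1 : G) (p.2 : PontryaginDual G))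
    have h1 := hcomm T fun u => by
      have h2 := (Equiv.mulLeft p).hasSum_iff.2 (hQ (gaborSystem μ K₁ K₂ u p))
      have h3 : ∀ q, ((fun i => ‖inner ℂ (gaborSystem μ K₁ K₂ u p) (gaborSystem μ K₁ K₂ g i)‖ ^ 2) ∘
          Equiv.mulLeft p) q = ‖inner ℂ u (gaborSystem μ K₁ K₂ g q)‖ ^ 2 := fun q => by
        simp only [Function.comp_apply, Equiv.coe_mulLeft, norm_inner_gaborSystem_mul]
      rw [funext h3] at h2
      exact (sq_eq_sq₀ (norm_nonneg _) (norm_nonneg _)).1 (h2.unique (hQ u))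
    exact (congrArg (fun S : Lp ℂ 2 μ →L[ℂ] Lp ℂ 2 μ => S u) h1.eq).symm
  have hRT : ∀ p u, R (gaborSystem μ K₁ K₂ u p) = gaborSystem μ K₁ K₂ (R u) p := fun p u => by
    have h1 : Q (R u) = u := congrArg (fun S : Lp ℂ 2 μ →L[ℂ] Lp ℂ 2 μ => S u) hQR
    conv_lhs => rw [← h1, ← hQT]
    exact congrArg (fun S : Lp ℂ 2 μ →L[ℂ] Lp ℂ 2 μ => S (gaborSystem μ K₁ K₂ (R u) p)) hRQ
  have hRs : star R = R := by
    have h1 : star R * Q = 1 := by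
      have := congrArg star hQR
      rw [star_mul, star_one] at this
      rwa [show star Q = Q from hQs] at this
    exact left_inv_eq_right_inv h1 hQR
  refine ⟨R g, Q, R, hQR, hRQ, fun p => hRT p g, fun u => ?_⟩
  -- Since `R` is self-adjoint, the sums for `h` at `u` are those for `g` at `R u`, namely `‖Q (R
  -- u)‖² = ‖u‖²`.
  have h1 := hQ (R u)
  have h2 : Q (R u) = u := congrArg (fun S : Lp ℂ 2 μ →L[ℂ] Lp ℂ 2 μ => S u) hQR
  have h3 : ∀ p, inner ℂ (R u) (gaborSystem μ K₁ K₂ g p) =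
      inner ℂ u (gaborSystem μ K₁ K₂ (R g) p) := fun p => by
    rw [← hRT, ← ContinuousLinearMap.adjoint_inner_left]
    exact congrArg (fun S : Lp ℂ 2 μ →L[ℂ] Lp ℂ 2 μ => inner ℂ (S u) _) hRs.symm
  change HasSum _ (‖Q (R u)‖ ^ 2) at h1
  rw [h2] at h1
  simpa only [h3] using h1

end Group

end GaborLCA

theorem theorem6 {G : Type*} [CommGroup G] [TopologicalSpace G] [IsTopologicalGroup G]
    [T2Space G] [LocallyCompactSpace G] [MeasurableSpace G] [BorelSpace G]
    (μ : MeasureTheory.Measure G) [μ.IsHaarMeasure] [μ.Regular]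
    (K₁ K₂ : Subgroup G)
    [DiscreteTopology K₁] [CompactSpace (G ⧸ K₁)]
    [DiscreteTopology K₂] [CompactSpace (G ⧸ K₂)]
    (g : MeasureTheory.Lp ℂ 2 μ) :
    (GaborLCA.quotientVolume μ K₁ / GaborLCA.quotientVolume μ K₂ > 1 →
      ¬ GaborLCA.IsFrame (GaborLCA.gaborSystem μ K₁ K₂ g)) ∧
    (GaborLCA.IsFrame (GaborLCA.gaborSystem μ K₁ K₂ g) →
      (GaborLCA.quotientVolume μ K₁ = GaborLCA.quotientVolume μ K₂ ↔
        GaborLCA.IsRieszBasis (GaborLCA.gaborSystem μ K₁ K₂ g))) := by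
  have hpos := GaborLCA.quotientVolume_pos μ K₂
  have key := GaborLCA.exists_parseval_window μ K₁ K₂ g
  refine ⟨fun hgt hfr => ?_, fun hfr => ?_⟩
  · obtain ⟨h, Q, R, hQR, hRQ, hRg, hP⟩ := key hfr
    have hvol := GaborLCA.quotientVolume_eq_mul_norm_sq_of_parseval μ K₁ K₂ h hP
    rw [hvol, mul_div_cancel_left₀ _ hpos.ne'] at hgt
    -- A single Parseval term gives `‖h‖⁴ ≤ ‖h‖²`, against `‖h‖² > 1`.
    have h1 := le_hasSum (hP (GaborLCA.gaborSystem μ K₁ K₂ h 1)) 1 fun _ _ => by positivity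
    rw [inner_self_eq_norm_sq_to_K] at h1
    have h2 : ‖GaborLCA.gaborSystem μ K₁ K₂ h 1‖ = ‖h‖ := GaborLCA.norm_modTrans μ _ _ h
    simp only [h2, norm_pow, RCLike.norm_ofReal, abs_norm] at h1
    nlinarith
  · obtain ⟨h, Q, R, hQR, hRQ, hRg, hP⟩ := key hfr
    have hvol := GaborLCA.quotientVolume_eq_mul_norm_sq_of_parseval μ K₁ K₂ h hP
    have hn : ∀ p, ‖GaborLCA.gaborSystem μ K₁ K₂ h p‖ = ‖h‖ := fun p =>
      GaborLCA.norm_modTrans μ _ _ h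
    have hQR' : ∀ u, Q (R u) = u := fun u => congrArg
      (fun S : MeasureTheory.Lp ℂ 2 μ →L[ℂ] MeasureTheory.Lp ℂ 2 μ => S u) hQR
    have hRQ' : ∀ u, R (Q u) = u := fun u => congrArg
      (fun S : MeasureTheory.Lp ℂ 2 μ →L[ℂ] MeasureTheory.Lp ℂ 2 μ => S u) hRQ
    have hiff : GaborLCA.quotientVolume μ K₁ = GaborLCA.quotientVolume μ K₂ ↔ ‖h‖ = 1 := by
      rw [hvol, mul_eq_left₀ hpos.ne', pow_eq_one_iff_of_nonneg (norm_nonneg _) two_ne_zero]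
    rw [hiff]
    constructor
    · intro h1
      obtain ⟨b, hb⟩ := GaborLCA.exists_hilbertBasis_of_parseval hP fun p => (hn p).trans h1
      refine ⟨b, Q, ⟨Function.LeftInverse.injective hRQ', Function.RightInverse.surjective hQR'⟩,
        fun p => ?_⟩
      rw [hb, ← hRg, hQR']
    · rintro ⟨b, U, hU, hUb⟩
      have hV : ∀ p, (R ∘L U) (b p) = GaborLCA.gaborSystem μ K₁ K₂ h p := fun p => by
        rw [ContinuousLinearMap.comp_apply, ← hUb, hRg]
      -- `R ∘ U` exhibits the system of `h` as a Parseval Riesz basis, hence of unit vectors.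
      have h1 := GaborLCA.norm_eq_one_of_parseval b (R ∘L U)
        ((Function.LeftInverse.injective hQR').comp hU.1) (by simpa only [hV] using hP) 1
      rwa [hV, hn] at h1
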